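/- **Setting.** Let $G=(V,E)$ be a finite connected simple graph with edge costs $c_e\ge 0$, let $T\subseteq V$ be nonempty with $|T|$ even, and fix a root $t^\star\in T$. Each node $v\in V\setminus T$ has a penalty $\pi(v)\ge 0$, and each $t\in T$ is given a large penalty $\pi(t)>2\sum_{e\in E}c_e$; write $\pi(X)=\sum_{v\in X}\pi(v)$. For a multiset $F$ of edges, $c(F)$ counts multiplicities; $F$ is a $D$-join if $D$ is the set of nodes of odd degree in $(V,F)$. A solution of the prize-collecting connected $T$-join problem is a pair $(I,F)$ with $I\subseteq V\setminus T$ and $F$ a connected $T$-join of $G\setminus I$ (a multiset of edges of $G\setminus I$ that is a $T$-join and connects all nodes of $V\setminus I$); its cost is $c(F)+\pi(I)$. Let $\mathcal Q$ be the family of sets $Q\subseteq V\setminus\{t^\star\}$ with $|Q\cap T|$ odd, and $\mathcal R$ the family of nonempty sets $R\subseteq V\setminus\{t^\star\}$ with $|R\cap T|$ even. Let $\delta(S)$ be the set of edges with exactly one end in $S$. Consider the linear program (L.P.4) $$\max \sum_{Q\in\mathcal Q}y_Q+\sum_{R\in\mathcal R}2y_R$$ subject to $\sum_{S\in\mathcal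 Q\cup\mathcal R,\ e\in\delta(S)}y_S\le c_e$ for $e\in E$, $\ \sum_{R\in\mathcal R,\ R\subseteq X}2y_R\le\pi(X)$ for $X\subseteq V\setminus\{t^\star\}$, and $y\ge0$. An edge $e$ is *tight*, and a set $X$ is *$\pi$-tight*, if its constraint holds with equality. **Algorithm.** Start with $y=0$, no chosen edges, and the partition of $V$ into singletons, all active except $\{t^\star\}$. While there is an active set, perform a phase: raise $y_S$ uniformly for all active sets $S$ by the same amount until (possibly at once) an edge between an active set and another set of the partition becomes tight, or an active set becomes $\pi$-tight. In the former case choose one such edge and merge the two sets that contain its ends; the new set is active unless it contains $t^\star$. In the latter case make one such active set inactive. Ties are broken arbitrarily. Then prune: as long as there are a set $X\not\ni t^\star$ that was inactive at some point and an edge $e$ such that $e$ is the only remaining chosen edge in $\delta(X)$, discard $e$. Let $J$ be the set of remaining edges in the component of $t^\star$, let $V(J)$ be the set of nodes incident to $J$, let $I=V\setminus V(J)$, and let $D$ be the set of nodes $v\in V(J)$ for which "$\deg_J(v)$ is odd" and "$v\in T$" are not equivalent. Let $M$ be a minimum-cost $D$-join of $G\setminus I$, and return $J\cup M$ (as a multiset).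 **Theorem.** In every execution, a further phase is possible as long as there is an active set, and there are at most $2|V|-2$ phases; the algorithm has an output. For every output, with final dual vector $y$: $y$ is feasible for (L.P.4), $J$ is a tree on $V(J)$, $(I,J\cup M)$ is a solution of the prize-collecting connected $T$-join problem, and $$\pi(I)=2\sum_{X\subseteq I}y_X,$$ $$c(J)\le\Bigl(2-\frac1{|T|-1}\Bigr)\sum_{Q\in\mathcal Q}y_Q+2\sum_{R\in\mathcal R,\ R\not\subseteq I}y_R,$$ $$c(M)\le\Bigl(1-\frac1{|T|-1}\Bigr)\sum_{Q\in\mathcal Q}y_Q+2\sum_{R\in\mathcal R,\ R\not\subseteq I}y_R;$$ the last bound also holds for every minimum-cost $D$-join of $G$ in place of $M$. Consequently, with $\rho=3-\frac{2}{|T|-1}$ if $|T|\ge4$ and $\rho=2$ if $|T|=2$, $$c(J\cup M)+\rho\,\pi(I)\le\rho\Bigl(\sum_{Q\in\mathcal Q}y_Q+\sum_{R\in\mathcal R}2y_R\Bigr),$$ and $c(J\cup M)+\rho\,\pi(I)\le\rho\,\bigl(c(F')+\pi(I')\bigr)$ for every solution $(I',F')$; that is, the algorithm is a Lagrangian-multiplier-preserving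 $\rho$-approximation. -/

import Mathlib

open scoped Classical

noncomputable section

/-- The data of an instance of the prize-collecting connected `T`-join problem, with a root. -/
structure PCInstance (V : Type*) where
  /-- the graph `G = (V, E)` -/
  graph : SimpleGraph V
  /-- the edge costs (only the values on edges of `graph` matter) -/
  cost : Sym2 V → ℝ
  /-- the set `T` -/
  T : Finset V
  /-- the root `t⋆` -/
  root : V
  /-- the node penalties `π` -/
  penalty : V → ℝ

/-- The edge `e` has exactly one endpoint in `S`, i.e. `e ∈ δ(S)`. -/
def Crosses {V : Type*} (S : Finset V) (e : Sym2 V) : Prop :=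
  ∃ u ∈ S, ∃ v, v ∉ S ∧ e = s(u, v)

/-- `δ_F(S)`: the edges of `F` with exactly one endpoint in `S`. -/
def cutIn {V : Type*} (F : Finset (Sym2 V)) (S : Finset V) : Finset (Sym2 V) :=
  F.filter (fun e => Crosses S e)

/-- The degree of `v` in the multiset of (non-loop) edges `M`. -/
def multiDegree {V : Type*} (M : Multiset (Sym2 V)) (v : V) : ℕ :=
  Multiset.card (M.filter (fun e => v ∈ e))

/-- `V(J)`: the nodes incident to an edge of `J`. -/
def incidentNodes {V : Type*} [Fintype V] (J : Finset (Sym2 V)) : Finset V :=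
  Finset.univ.filter (fun v => ∃ e ∈ J, v ∈ e)

/-- The configuration of the growing phase of the algorithm. -/
structure GrowState (V : Type*) where
  /-- the current partition of the nodes -/
  comps : Finset (Finset V)
  /-- the active sets of the current partition -/
  active : Finset (Finset V)
  /-- the sets not containing the root that have been inactive at some point so far
  (these are exactly the active sets that have become `π`-tight and were made inactive) -/
  deactivated : Finset (Finset V)
  /-- the dual variables -/
  y : Finset V → ℝ
  /-- the edges chosen so far -/
  F : Finset (Sym2 V)

/-- The dual variables after those of all active sets have been raised by `Δ`. -/
def GrowState.raise {V : Type*} (s : GrowState V) (Δ : ℝ) : Finset V → ℝ :=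
  fun S => s.y S + if S ∈ s.active then Δ else 0

namespace PCInstance

variable {V : Type*} [Fintype V] (P : PCInstance V)

/-- The edge set of the graph as a finset. -/
def edges : Finset (Sym2 V) := Finset.univ.filter (fun e => e ∈ P.graph.edgeSet)

/-- `c(M)` for a multiset of edges `M`, counted with multiplicity. -/
def multiCost (M : Multiset (Sym2 V)) : ℝ := (M.map P.cost).sum

/-- `π(X)`. -/
def pen (X : Finset V) : ℝ := ∑ v ∈ X, P.penalty v

/-- `𝒬`: the `T`-odd subsets of `V - t⋆`. -/
def oddSets : Finset (Finset V) :=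
  Finset.univ.filter (fun S => P.root ∉ S ∧ Odd (S ∩ P.T).card)

/-- `ℛ`: the nonempty `T`-even subsets of `V - t⋆`. -/
def evenSets : Finset (Finset V) :=
  Finset.univ.filter (fun S => P.root ∉ S ∧ S.Nonempty ∧ Even (S ∩ P.T).card)

/-! ### Joins and feasible solutions -/

/-- `M` is a `D`-join of the induced subgraph `G[U]`: a multiset of edges of `G` with both
endpoints in `U` such that `D` is the set of nodes of odd degree. -/
def IsJoin (U D : Finset V) (M : Multiset (Sym2 V)) : Prop :=
  (∀ e ∈ M, e ∈ P.graph.edgeSet ∧ ∀ v ∈ e, v ∈ U) ∧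
    ∀ v, Odd (multiDegree M v) ↔ v ∈ D

/-- `M` is a minimum-cost `D`-join of `G[U]`. -/
def IsMinCostJoin (U D : Finset V) (M : Multiset (Sym2 V)) : Prop :=
  P.IsJoin U D M ∧ ∀ M', P.IsJoin U D M' → P.multiCost M ≤ P.multiCost M'

/-- `F` is a connected `T`-join of `G ∖ I`. -/
def IsConnectedTJoin (I : Finset V) (F : Multiset (Sym2 V)) : Prop :=
  P.IsJoin Iᶜ P.T F ∧
    ((SimpleGraph.fromEdgeSet {e | e ∈ F}).induce {v | v ∉ I}).Connected

/-- `(I, F)` is a feasible solution of the prize-collecting connected `T`-join problem: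
`I ⊆ V ∖ T` and `F` is a connected `T`-join of `G ∖ I`. Its value is `c(F) + π(I)`. -/
def IsSolution (I : Finset V) (F : Multiset (Sym2 V)) : Prop :=
  Disjoint I P.T ∧ P.IsConnectedTJoin I F

/-! ### The dual linear program -/

/-- Left-hand side of the dual constraint of the edge `e`. -/
def edgeLoad (y : Finset V → ℝ) (e : Sym2 V) : ℝ :=
  ∑ S ∈ (P.oddSets ∪ P.evenSets).filter (fun S => Crosses S e), y S

/-- Left-hand side of the dual constraint of the node set `X`. -/
def penLoad (y : Finset V → ℝ) (X : Finset V) : ℝ :=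
  ∑ R ∈ P.evenSets.filter (fun R => R ⊆ X), 2 * y R

/-- Feasibility for the dual linear program. -/
def DualFeasible (y : Finset V → ℝ) : Prop :=
  (∀ e ∈ P.edges, P.edgeLoad y e ≤ P.cost e) ∧
    (∀ X : Finset V, P.root ∉ X → P.penLoad y X ≤ P.pen X) ∧
      ∀ S ∈ P.oddSets ∪ P.evenSets, 0 ≤ y S

/-- The objective function of the dual linear program. -/
def dualValue (y : Finset V → ℝ) : ℝ :=
  ∑ Q ∈ P.oddSets, y Q + ∑ R ∈ P.evenSets, 2 * y R

/-! ### The growing phase -/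

/-- The initial configuration. -/
def initState : GrowState V where
  comps := Finset.univ.image (fun v => {v})
  active := (Finset.univ.erase P.root).image (fun v => {v})
  deactivated := ∅
  y := fun _ => 0
  F := ∅

/-- Some set is active, and raising the dual variables of all active sets by `Δ ≥ 0` does not
go beyond the moment at which some edge becomes tight or some active set becomes `π`-tight. -/
def CanRaise (s : GrowState V) (Δ : ℝ) : Prop :=
  s.active.Nonempty ∧ 0 ≤ Δ ∧
    (∀ e ∈ P.edges, P.edgeLoad (s.raise Δ) e ≤ P.cost e) ∧
      ∀ S ∈ s.active, P.penLoad (s.raise Δ) S ≤ P.pen S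

/-- One phase of the algorithm. Ties are broken arbitrarily. -/
inductive Phase : GrowState V → GrowState V → Prop
  /-- An edge `uv` between an active set `A` and another set `B` of the partition becomes tight;
  it is chosen, and `A` and `B` are merged; the new set is active unless it contains the root. -/
  | merge (s : GrowState V) (Δ : ℝ) (A B : Finset V) (u v : V)
      (hraise : P.CanRaise s Δ)
      (hA : A ∈ s.active) (hB : B ∈ s.comps) (hAB : A ≠ B)
      (hu : u ∈ A) (hv : v ∈ B) (he : s(u, v) ∈ P.edges)
      (htight : P.edgeLoad (s.raise Δ) s(u, v) = P.cost s(u, v)) :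
      Phase s
        { comps := insert (A ∪ B) ((s.comps.erase A).erase B)
          active :=
            if P.root ∈ A ∪ B then (s.active.erase A).erase B
            else insert (A ∪ B) ((s.active.erase A).erase B)
          deactivated := s.deactivated
          y := s.raise Δ
          F := insert s(u, v) s.F }
  /-- An active set `S` becomes `π`-tight and is made inactive. -/
  | deactivate (s : GrowState V) (Δ : ℝ) (S : Finset V)
      (hraise : P.CanRaise s Δ)
      (hS : S ∈ s.active)
      (htight : P.penLoad (s.raise Δ) S = P.pen S) :
      Phase s
        { comps := s.comps
          active := s.active.erase S
          deactivated := insert S s.deactivated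
          y := s.raise Δ
          F := s.F }

/-- `P.Run n s`: the configuration `s` can be reached after exactly `n` phases. -/
inductive Run : ℕ → GrowState V → Prop
  | init : Run 0 P.initState
  | phase {n : ℕ} {s s' : GrowState V} (hrun : Run n s) (hphase : P.Phase s s') : Run (n + 1) s'

/-! ### Pruning and output -/

/-- One pruning step: some edge `e` is discarded for which there is a set `X ∌ t⋆`, inactive at
some point of the algorithm, such that `e` is the only remaining edge in `δ(X)`. (There is such
an `X` if and only if there is an inclusion-wise maximal one.) -/
def PruneStep {V : Type*} (inactive : Finset (Finset V)) (F F' : Finset (Sym2 V)) : Prop :=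
  ∃ X ∈ inactive, ∃ e, cutIn F X = {e} ∧ F' = F.erase e

/-- `F'` is obtained from the edge set `F` by pruning as long as possible. -/
def PrunesTo {V : Type*} (inactive : Finset (Finset V)) (F F' : Finset (Sym2 V)) : Prop :=
  Relation.ReflTransGen (PruneStep inactive) F F' ∧ ∀ F'', ¬ PruneStep inactive F' F''

/-- The edges of `F` in the component of the root. -/
def rootPart (F : Finset (Sym2 V)) : Finset (Sym2 V) :=
  F.filter (fun e => ∀ v ∈ e,
    (SimpleGraph.fromEdgeSet (F : Set (Sym2 V))).Reachable P.root v)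

/-- The nodes of `V(J)` that have the wrong degree in `J`. -/
def wrongNodes (J : Finset (Sym2 V)) : Finset V :=
  (incidentNodes J).filter (fun v => ¬ (Odd (multiDegree J.val v) ↔ v ∈ P.T))

/-- `(s, J)` are the final configuration of the growing phase and the tree of some execution of
the algorithm. -/
def IsTreeOutput (s : GrowState V) (J : Finset (Sym2 V)) : Prop :=
  (∃ n, P.Run n s) ∧ s.active = ∅ ∧
    ∃ F', PrunesTo s.deactivated s.F F' ∧ J = P.rootPart F'

/-- `(s, J, M)` are the final configuration of the growing phase, the tree and the `D`-join of
some execution of the algorithm; the `D`-join is taken in `G[V(J)]`, and the output is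
`J ∪ M` (as multisets). -/
def IsOutput (s : GrowState V) (J : Finset (Sym2 V)) (M : Multiset (Sym2 V)) : Prop :=
  P.IsTreeOutput s J ∧ P.IsMinCostJoin (incidentNodes J) (P.wrongNodes J) M

/-- The Lagrangian-multiplier-preserving guarantee with factor `ρ` of a solution `(I, F)`,
with respect to the dual solution `y` and to every feasible solution. -/
def LMPGuarantee (ρ : ℝ) (y : Finset V → ℝ) (I : Finset V) (F : Multiset (Sym2 V)) : Prop :=
  P.multiCost F + ρ * P.pen I ≤ ρ * P.dualValue y ∧
    ∀ I' F', P.IsSolution I' F' →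
      P.multiCost F + ρ * P.pen I ≤ ρ * (P.multiCost F' + P.pen I')

end PCInstance

end

/-! ### Edges crossing a node set -/

section Crossing

variable {V : Type*}

/-! The argument is primal-dual. The dual `y` stays feasible because `CanRaise` guards the edges and
the active sets, and penalty constraints decompose along the partition
(`Valid.penLoad_le_of_comps`). A potential (number of blocks plus number of active sets) bounds the
number of phases. Large penalties keep `T` out of all deactivated sets, so `J` spans `T`. The
discarded set `I` is a union of deactivated sets, and uncrossing makes such unions `π`-tight; hence
`π(I)` is paid for exactly by the dual sets inside `I`.

The cost of `J` is the total load of its tight edges. At any moment of the growth, contracting the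
blocks of the partition turns `J` into a forest with degree sum at most twice the number of blocks
met, minus 2 (`Valid.sum_card_cutIn_le`). Inactive blocks without the root that meet `J` have degree
at least 2, since pruning leaves no leaf among them. So active blocks have average degree below 2,
with a surplus that is shared among the at most `|T| - 1` active `T`-odd sets. Integrating this over
the growth (`Valid.sum_slackRate_nonneg`, `Valid.sum_mul_slackRate_le`) bounds `c(J)`.

For `M`: the tree `J` contains a `T`-join `N`, and `J \ N` is a `D`-join. Since `N` crosses every
`T`-odd set, `c(N)` is at least the sum of the `y_Q`, so `c(M)` is bounded by `c(J)` minus that sum.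
Weak duality then compares with every solution. -/

theorem crosses_mk {S : Finset V} {u v : V} :
    Crosses S s(u, v) ↔ (u ∈ S ∧ v ∉ S) ∨ (v ∈ S ∧ u ∉ S) := by
  constructor
  · rintro ⟨a, ha, b, hb, h⟩
    rcases Sym2.eq_iff.1 h with ⟨rfl, rfl⟩ | ⟨rfl, rfl⟩
    · exact Or.inl ⟨ha, hb⟩
    · exact Or.inr ⟨ha, hb⟩
  · rintro (⟨hu, hv⟩ | ⟨hv, hu⟩)
    · exact ⟨u, hu, v, hv, rfl⟩
    · exact ⟨v, hv, u, hu, Sym2.eq_swap⟩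

theorem mem_cutIn {F : Finset (Sym2 V)} {S : Finset V} {e : Sym2 V} :
    e ∈ cutIn F S ↔ e ∈ F ∧ Crosses S e := by
  simp [cutIn]

theorem exists_crosses_of_reachable {E : Set (Sym2 V)} {S : Finset V} {a b : V}
    (h : (SimpleGraph.fromEdgeSet E).Reachable a b) (ha : a ∈ S) (hb : b ∉ S) :
    ∃ e ∈ E, Crosses S e := by
  obtain ⟨p⟩ := h
  obtain ⟨d, -, h1, h2⟩ := p.exists_boundary_dart (S : Set V) (by simpa using ha) (by simpa using hb)
  exact ⟨s(d.fst, d.snd), ((SimpleGraph.fromEdgeSet_adj _).1 d.adj).1,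
    d.fst, by simpa using h1, d.snd, by simpa using h2, rfl⟩

theorem SimpleGraph.Reachable.induct {G : SimpleGraph V} {p : V → Prop} {u v : V}
    (h : G.Reachable u v) (hu : p u) (hstep : ∀ a b, G.Adj a b → p a → p b) : p v := by
  obtain ⟨w⟩ := h
  induction w with
  | nil => exact hu
  | cons hadj _ ih => exact ih (hstep _ _ hadj hu)

/-- The number of ends in `S` of the edges in `M` has the parity of the number of edges of `M`
that cross `S`. -/
theorem exists_sum_multiDegree_eq (S : Finset V) (M : Multiset (Sym2 V))
    (hM : ∀ e ∈ M, ¬ e.IsDiag) :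
    ∃ k, ∑ v ∈ S, multiDegree M v = Multiset.card (M.filter (fun e => Crosses S e)) + 2 * k := by
  induction M using Multiset.induction with
  | empty => exact ⟨0, by simp [multiDegree]⟩
  | cons e M ih =>
    obtain ⟨k, hk⟩ := ih fun e' he' => hM e' (Multiset.mem_cons_of_mem he')
    have hdeg : ∀ v, multiDegree (e ::ₘ M) v = multiDegree M v + if v ∈ e then 1 else 0 := by
      intro v
      by_cases h : v ∈ e <;> simp [multiDegree, h]
    have hcard : Multiset.card ((e ::ₘ M).filter (fun e => Crosses S e)) =
        Multiset.card (M.filter (fun e => Crosses S e)) + if Crosses S e then 1 else 0 := by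
      by_cases h : Crosses S e <;> simp [h]
    have hne := hM e (Multiset.mem_cons_self e M)
    simp only [hdeg, Finset.sum_add_distrib, hk, hcard]
    induction e using Sym2.ind with
    | _ u v =>
      have huv : u ≠ v := by simpa using hne
      have hends : ∑ w ∈ S, (if w ∈ s(u, v) then 1 else 0) =
          (if u ∈ S then 1 else 0) + if v ∈ S then 1 else 0 := by
        rw [← Finset.sum_ite_eq' S u fun _ => 1, ← Finset.sum_ite_eq' S v fun _ => 1,
          ← Finset.sum_add_distrib]
        refine Finset.sum_congr rfl fun w _ => ?_
        by_cases h1 : w = u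
        · subst h1; simp [huv]
        · simp [h1]
      rw [hends, crosses_mk]
      by_cases hu : u ∈ S <;> by_cases hv : v ∈ S
      -- An edge with both ends in `S` contributes two ends and no crossing.
      · exact ⟨k + 1, by simp [hu, hv]; ring⟩
      all_goals exact ⟨k, by simp [hu, hv]; try ring⟩

theorem odd_card_crosses_iff (S D : Finset V) (M : Multiset (Sym2 V))
    (hM : ∀ e ∈ M, ¬ e.IsDiag) (hD : ∀ v, Odd (multiDegree M v) ↔ v ∈ D) :
    Odd (Multiset.card (M.filter (fun e => Crosses S e))) ↔ Odd (S ∩ D).card := by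
  obtain ⟨k, hk⟩ := exists_sum_multiDegree_eq S M hM
  have h1 := Finset.odd_sum_iff_odd_card_odd (s := S) (multiDegree M)
  have h2 : {x ∈ S | Odd (multiDegree M x)} = S ∩ D := by
    ext v; simp [hD]
  rw [h2, hk] at h1
  rw [← h1]
  simp [Nat.odd_add]

end Crossing

/-! ### Existence of joins -/

section Joins

variable {V : Type*}

theorem multiDegree_add (M N : Multiset (Sym2 V)) (v : V) :
    multiDegree (M + N) v = multiDegree M v + multiDegree N v := by
  simp [multiDegree]

theorem multiDegree_val (F : Finset (Sym2 V)) (v : V) :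
    multiDegree F.val v = (F.filter (fun e => v ∈ e)).card := rfl

/-- Degree parities are additive over the field with two elements, with symmetric difference as
addition. Joins can thus be combined without asking for disjoint paths. -/
theorem odd_multiDegree_symmDiff (N N' : Finset (Sym2 V)) (v : V) :
    Odd (multiDegree (symmDiff N N').val v) ↔
      ¬ (Odd (multiDegree N.val v) ↔ Odd (multiDegree N'.val v)) := by
  simp only [multiDegree_val]
  set A := N.filter (fun e => v ∈ e)
  set B := N'.filter (fun e => v ∈ e)
  have h1 : (symmDiff N N').filter (fun e => v ∈ e) = (A \ B) ∪ (B \ A) := by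
    ext e; simp only [A, B, Finset.mem_filter, Finset.mem_symmDiff, Finset.mem_union,
      Finset.mem_sdiff]; tauto
  have h2 : Disjoint (A \ B) (B \ A) := disjoint_sdiff_sdiff
  rw [h1, Finset.card_union_of_disjoint h2]
  have h3 := Finset.card_sdiff_add_card_inter A B
  have h4 := Finset.card_sdiff_add_card_inter B A
  rw [Finset.inter_comm] at h4
  rw [← h3, ← h4]
  simp only [Nat.odd_add, ← Nat.not_odd_iff_even]
  tauto

/-- Toggling the edges of a walk one by one gives the join, even if the walk repeats edges. The
right-hand side is membership in the symmetric difference of `{u}` and `{v}`, which is empty when `u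
= v`. -/
theorem exists_join_pair {J : Finset (Sym2 V)} {u v : V}
    (h : (SimpleGraph.fromEdgeSet (J : Set (Sym2 V))).Reachable u v) :
    ∃ N ⊆ J, ∀ w, Odd (multiDegree N.val w) ↔ ¬ (w = u ↔ w = v) := by
  refine h.induct (p := fun v => ∃ N ⊆ J, ∀ w, Odd (multiDegree N.val w) ↔ ¬ (w = u ↔ w = v))
    ⟨∅, by simp, by simp [multiDegree]⟩ ?_
  rintro a b hab ⟨N, hN, hodd⟩
  obtain ⟨hmem, hne⟩ := (SimpleGraph.fromEdgeSet_adj _).1 hab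
  refine ⟨symmDiff N {s(a, b)}, ?_, fun w => ?_⟩
  · intro e he
    rcases Finset.mem_symmDiff.1 he with h | h
    · exact hN h.1
    · rw [Finset.mem_singleton.1 h.1]; simpa using hmem
  · have hs : Odd (multiDegree ({s(a, b)} : Finset (Sym2 V)).val w) ↔ (w = a ∨ w = b) := by
      by_cases hw : w ∈ s(a, b)
      · simp [multiDegree, Multiset.filter_singleton, ← Sym2.mem_iff, hw]
      · simp [multiDegree, Multiset.filter_singleton, ← Sym2.mem_iff, hw]
    rw [odd_multiDegree_symmDiff, hodd, hs]
    have : ¬ (w = a ∧ w = b) := fun h => hne (h.1.symm.trans h.2)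
    tauto

theorem exists_join_of_reachable {J : Finset (Sym2 V)} {r : V} (D : Finset V)
    (h : ∀ v ∈ D, (SimpleGraph.fromEdgeSet (J : Set (Sym2 V))).Reachable r v) (hD : Even D.card) :
    ∃ N ⊆ J, ∀ w, Odd (multiDegree N.val w) ↔ w ∈ D := by
  -- To allow induction on `D`, sets of odd size are admitted and the surplus parity is put at `r`.
  have key : ∃ N ⊆ J, ∀ w, Odd (multiDegree N.val w) ↔ ¬ (w ∈ D ↔ (w = r ∧ Odd D.card)) := by
    clear hD
    induction D using Finset.induction_on with
    | empty => exact ⟨∅, by simp, by simp [multiDegree]⟩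
    | insert v D hv ih =>
      obtain ⟨N, hN, hodd⟩ := ih fun v hv => h v (Finset.mem_insert_of_mem hv)
      obtain ⟨N', hN', hodd'⟩ := exists_join_pair (h v (Finset.mem_insert_self v D))
      refine ⟨symmDiff N N', ?_, fun w => ?_⟩
      · intro e he
        rcases Finset.mem_symmDiff.1 he with h | h
        · exact hN h.1
        · exact hN' h.1
      · rw [odd_multiDegree_symmDiff, hodd, hodd', Finset.mem_insert, Finset.card_insert_of_notMem hv,
          Nat.odd_add_one]
        have : ¬ (w = v ∧ w ∈ D) := fun h => hv (h.1 ▸ h.2)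
        tauto
  obtain ⟨N, hN, hodd⟩ := key
  refine ⟨N, hN, fun w => ?_⟩
  rw [hodd, ← Nat.not_even_iff_odd]
  tauto

/-- The edges of odd multiplicity. -/
noncomputable def oddPart (M : Multiset (Sym2 V)) : Finset (Sym2 V) :=
  M.toFinset.filter (fun e => Odd (M.count e))

theorem oddPart_cons (e : Sym2 V) (M : Multiset (Sym2 V)) :
    oddPart (e ::ₘ M) = symmDiff (oddPart M) {e} := by
  ext a
  simp only [oddPart, Finset.mem_filter, Multiset.mem_toFinset, Finset.mem_symmDiff,
    Finset.mem_singleton, Multiset.mem_cons]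
  by_cases ha : a = e
  · subst ha
    by_cases hM : a ∈ M
    · simp [Nat.odd_add_one, hM]
    · simp [hM]
  · simp [ha, Multiset.count_cons_of_ne ha]

theorem odd_multiDegree_oddPart (M : Multiset (Sym2 V)) (v : V) :
    Odd (multiDegree (oddPart M).val v) ↔ Odd (multiDegree M v) := by
  induction M using Multiset.induction with
  | empty => simp [oddPart]
  | cons e M ih =>
    rw [oddPart_cons, odd_multiDegree_symmDiff, ih]
    by_cases h : v ∈ e
    · simp [multiDegree, h, Multiset.filter_singleton, Nat.odd_add_one]
    · simp [multiDegree, h, Multiset.filter_singleton]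

theorem oddPart_val_le (M : Multiset (Sym2 V)) : (oddPart M).val ≤ M :=
  (Multiset.le_iff_subset (oddPart M).nodup).2 fun e he => by
    have : e ∈ oddPart M := he
    exact Multiset.mem_toFinset.1 (Finset.mem_filter.1 this).1

end Joins

/-! ### Minimum-cost joins. -/

namespace PCInstance

variable {V : Type*} [Fintype V] (P : PCInstance V)

omit [Fintype V] in
theorem multiCost_add (M N : Multiset (Sym2 V)) :
    P.multiCost (M + N) = P.multiCost M + P.multiCost N := by
  simp [multiCost]

omit [Fintype V] in
theorem multiCost_le_of_le {M N : Multiset (Sym2 V)} (h : M ≤ N) (hN : ∀ e ∈ N, 0 ≤ P.cost e) :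
    P.multiCost M ≤ P.multiCost N := by
  obtain ⟨K, rfl⟩ := Multiset.le_iff_exists_add.1 h
  rw [multiCost_add]
  have : 0 ≤ P.multiCost K := Multiset.sum_nonneg fun x hx => by
    obtain ⟨e, he, rfl⟩ := Multiset.mem_map.1 hx
    exact hN e (by simp [he])
  linarith

/-- There are infinitely many multisets, but removing pairs of equal edges preserves all parities
and does not raise the cost. So it suffices to minimise over the finitely many simple edge sets. -/
theorem exists_isMinCostJoin (hcost : ∀ e ∈ P.graph.edgeSet, 0 ≤ P.cost e) {U D : Finset V}
    {M₀ : Multiset (Sym2 V)} (h₀ : P.IsJoin U D M₀) : ∃ M, P.IsMinCostJoin U D M := by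
  have hred : ∀ M, P.IsJoin U D M → P.IsJoin U D (oddPart M).val := fun M hM =>
    ⟨fun e he => hM.1 e (Multiset.mem_of_le (oddPart_val_le M) he), fun v => by
      rw [odd_multiDegree_oddPart, hM.2]⟩
  have hne : (Finset.univ.filter fun N : Finset (Sym2 V) => P.IsJoin U D N.val).Nonempty :=
    ⟨oddPart M₀, by simpa using hred M₀ h₀⟩
  obtain ⟨N, hN, hmin⟩ := Finset.exists_min_image _ (fun N => P.multiCost N.val) hne
  refine ⟨N.val, by simpa using hN, fun M hM => ?_⟩
  exact (hmin (oddPart M) (by simpa using hred M hM)).trans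
    (P.multiCost_le_of_le (oddPart_val_le M) fun e he => hcost e (hM.1 e he).1)

/-! ### Exchanging sums over edges and over node sets -/

theorem mem_oddSets {S : Finset V} : S ∈ P.oddSets ↔ P.root ∉ S ∧ Odd (S ∩ P.T).card := by
  simp [oddSets]

theorem mem_evenSets {S : Finset V} :
    S ∈ P.evenSets ↔ P.root ∉ S ∧ S.Nonempty ∧ Even (S ∩ P.T).card := by
  simp [evenSets]

theorem mem_edges {e : Sym2 V} : e ∈ P.edges ↔ e ∈ P.graph.edgeSet := by
  simp [edges]

theorem disjoint_oddSets_evenSets : Disjoint P.oddSets P.evenSets :=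
  Finset.disjoint_left.2 fun _ h h' =>
    Nat.not_even_iff_odd.2 (P.mem_oddSets.1 h).2 (P.mem_evenSets.1 h').2.2

theorem mem_oddSets_union_evenSets {S : Finset V} :
    S ∈ P.oddSets ∪ P.evenSets ↔ P.root ∉ S ∧ S.Nonempty := by
  rw [Finset.mem_union, mem_oddSets, mem_evenSets]
  constructor
  · rintro (h | h)
    · refine ⟨h.1, Finset.nonempty_iff_ne_empty.2 ?_⟩
      rintro rfl
      simp at h
    · exact ⟨h.1, h.2.1⟩
  · rintro ⟨h1, h2⟩
    rcases Nat.even_or_odd (S ∩ P.T).card with h | h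
    · exact Or.inr ⟨h1, h2, h⟩
    · exact Or.inl ⟨h1, h⟩

theorem sum_map_edgeLoad (y : Finset V → ℝ) (M : Multiset (Sym2 V)) :
    (M.map (P.edgeLoad y)).sum =
      ∑ S ∈ P.oddSets ∪ P.evenSets,
        y S * (Multiset.card (M.filter (fun e => Crosses S e)) : ℝ) := by
  induction M using Multiset.induction with
  | empty => simp
  | cons e M ih =>
    rw [Multiset.map_cons, Multiset.sum_cons, ih, edgeLoad, Finset.sum_filter,
      ← Finset.sum_add_distrib]
    refine Finset.sum_congr rfl fun S _ => ?_
    by_cases h : Crosses S e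
    · simp [h]; ring
    · simp [h]

theorem sum_edgeLoad (y : Finset V → ℝ) (F : Finset (Sym2 V)) :
    ∑ e ∈ F, P.edgeLoad y e =
      ∑ S ∈ P.oddSets ∪ P.evenSets, y S * ((cutIn F S).card : ℝ) :=
  P.sum_map_edgeLoad y F.val

omit [Fintype V] in
theorem not_isDiag_of_isJoin {U D : Finset V} {M : Multiset (Sym2 V)} (h : P.IsJoin U D M) :
    ∀ e ∈ M, ¬ e.IsDiag := fun e he => P.graph.not_isDiag_of_mem_edgeSet (h.1 e he).1

/-- A `T`-join pays for the load of its edges, and it crosses every `T`-odd set. -/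
theorem sum_map_edgeLoad_le_and_one_le_card_crosses {y : Finset V → ℝ}
    (hy : P.DualFeasible y) {M : Multiset (Sym2 V)}
    (hM : ∀ e ∈ M, e ∈ P.graph.edgeSet) (hodd : ∀ v, Odd (multiDegree M v) ↔ v ∈ P.T) :
    (M.map (P.edgeLoad y)).sum ≤ P.multiCost M ∧
    ∀ Q ∈ P.oddSets, (1 : ℝ) ≤ Multiset.card (M.filter (fun e => Crosses Q e)) := by
  constructor
  · exact Multiset.sum_map_le_sum_map _ _ fun e he => hy.1 e (P.mem_edges.2 (hM e he))
  · intro Q hQ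
    have := (odd_card_crosses_iff Q P.T M
      (fun e he => P.graph.not_isDiag_of_mem_edgeSet (hM e he)) hodd).2 (P.mem_oddSets.1 hQ).2
    exact_mod_cast this.pos

/-- Weak duality. -/
theorem dualValue_le_of_isSolution (hroot : P.root ∈ P.T) {y : Finset V → ℝ}
    (hy : P.DualFeasible y) {I : Finset V} {F : Multiset (Sym2 V)} (h : P.IsSolution I F) :
    P.dualValue y ≤ P.multiCost F + P.pen I := by
  obtain ⟨hIT, hjoin, hcon⟩ := h
  have hrI : P.root ∉ I := fun h => Finset.disjoint_left.1 hIT h hroot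
  obtain ⟨hle, hoddQ⟩ := P.sum_map_edgeLoad_le_and_one_le_card_crosses hy
    (fun e he => (hjoin.1 e he).1) hjoin.2
  have hpen := hy.2.1 I hrI
  rw [sum_map_edgeLoad, Finset.sum_union P.disjoint_oddSets_evenSets] at hle
  have hQ : ∑ Q ∈ P.oddSets, y Q ≤ ∑ S ∈ P.oddSets,
      y S * (Multiset.card (F.filter (fun e => Crosses S e)) : ℝ) :=
    Finset.sum_le_sum fun Q hQ =>
      le_mul_of_one_le_right (hy.2.2 Q (Finset.mem_union_left _ hQ)) (hoddQ Q hQ)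
  -- Sets inside `I` are charged to the penalty constraint of `I`. Any other `R` separates a node of
  -- `V \ I` from the root, so connectivity gives a crossing edge, and parity makes it at least two.
  have hR : ∑ R ∈ P.evenSets, 2 * y R ≤ ∑ S ∈ P.evenSets,
      y S * (Multiset.card (F.filter (fun e => Crosses S e)) : ℝ) + P.penLoad y I := by
    rw [penLoad, Finset.sum_filter, ← Finset.sum_add_distrib]
    refine Finset.sum_le_sum fun R hR => ?_
    have hyR := hy.2.2 R (Finset.mem_union_right _ hR)
    obtain ⟨hrR, -, heven⟩ := P.mem_evenSets.1 hR
    by_cases hRI : R ⊆ I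
    · simp only [hRI, if_true]
      have : 0 ≤ y R * (Multiset.card (F.filter (fun e => Crosses R e)) : ℝ) := by positivity
      linarith
    · obtain ⟨v, hvR, hvI⟩ := Finset.not_subset.1 hRI
      have hreach := (hcon.preconnected ⟨v, hvI⟩ ⟨P.root, hrI⟩).map
        (SimpleGraph.Embedding.induce {v | v ∉ I}).toHom
      obtain ⟨e, he, hcr⟩ := exists_crosses_of_reachable hreach hvR hrR
      have hpos : 0 < Multiset.card (F.filter (fun e => Crosses R e)) :=
        Multiset.card_pos_iff_exists_mem.2 ⟨e, Multiset.mem_filter.2 ⟨he, hcr⟩⟩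
      have hev : Even (Multiset.card (F.filter (fun e => Crosses R e))) := by
        rw [← Nat.not_odd_iff_even,
          odd_card_crosses_iff R P.T F (P.not_isDiag_of_isJoin hjoin) hjoin.2,
          Nat.not_odd_iff_even]
        exact heven
      have h2 : 2 ≤ Multiset.card (F.filter (fun e => Crosses R e)) := by
        obtain ⟨k, hk⟩ := hev
        omega
      have h2' : (2 : ℝ) ≤ Multiset.card (F.filter (fun e => Crosses R e)) := by exact_mod_cast h2
      simp only [hRI, if_false, add_zero]
      nlinarith
  rw [dualValue]
  linarith

end PCInstance

namespace PCInstance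

variable {V : Type*} [Fintype V] (P : PCInstance V)

/-! ### The invariants of the growing phase -/

/-- The invariants of the growing phase. -/
structure Valid (s : GrowState V) : Prop where
  cover : ∀ v, ∃ C ∈ s.comps, v ∈ C
  eq_of_mem : ∀ C ∈ s.comps, ∀ C' ∈ s.comps, ∀ v ∈ C, v ∈ C' → C = C'
  nonempty : ∀ C ∈ s.comps, C.Nonempty
  active_comps : ∀ S ∈ s.active, S ∈ s.comps
  root_notMem_active : ∀ S ∈ s.active, P.root ∉ S
  mem_deactivated : ∀ C ∈ s.comps, P.root ∉ C → C ∉ s.active → C ∈ s.deactivated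
  y_nonneg : ∀ S, 0 ≤ s.y S
  y_support : ∀ S, s.y S ≠ 0 → S.Nonempty ∧ P.root ∉ S ∧ ∃ C ∈ s.comps, S ⊆ C
  edgeLoad_le : ∀ e ∈ P.edges, P.edgeLoad s.y e ≤ P.cost e
  penLoad_le : ∀ X, P.root ∉ X → P.penLoad s.y X ≤ P.pen X
  root_notMem_deactivated : ∀ X ∈ s.deactivated, P.root ∉ X
  deactivated_sub : ∀ X ∈ s.deactivated, ∃ C ∈ s.comps, X ⊆ C
  deactivated_tight : ∀ X ∈ s.deactivated, P.penLoad s.y X = P.pen X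
  deactivated_notMem_active : ∀ X ∈ s.deactivated, X ∉ s.active
  laminar : ∀ X ∈ s.deactivated, ∀ X' ∈ s.deactivated, X ⊆ X' ∨ X' ⊆ X ∨ Disjoint X X'
  F_edges : ∀ e ∈ s.F, e ∈ P.edges
  F_tight : ∀ e ∈ s.F, P.edgeLoad s.y e = P.cost e
  F_inside : ∀ e ∈ s.F, ∃ C ∈ s.comps, ∀ v ∈ e, v ∈ C
  reachable : ∀ C ∈ s.comps, ∀ u ∈ C, ∀ v ∈ C,
    (SimpleGraph.fromEdgeSet (s.F : Set (Sym2 V))).Reachable u v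
  acyclic : (SimpleGraph.fromEdgeSet (s.F : Set (Sym2 V))).IsAcyclic

theorem valid_initState (hcost : ∀ e ∈ P.graph.edgeSet, 0 ≤ P.cost e) (hpen : ∀ v, 0 ≤ P.penalty v) :
    P.Valid P.initState where
  cover v := ⟨{v}, by simp [initState]⟩
  eq_of_mem := by
    intro C hC C' hC' v hv hv'
    simp only [initState, Finset.mem_image, Finset.mem_univ, true_and] at hC hC'
    obtain ⟨a, rfl⟩ := hC
    obtain ⟨b, rfl⟩ := hC'
    rw [← Finset.mem_singleton.1 hv, ← Finset.mem_singleton.1 hv']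
  nonempty := by
    intro C hC
    simp only [initState, Finset.mem_image, Finset.mem_univ, true_and] at hC
    obtain ⟨a, rfl⟩ := hC
    simp
  active_comps := by
    intro S hS
    simp only [initState, Finset.mem_image, Finset.mem_erase, Finset.mem_univ, and_true,
      true_and] at hS ⊢
    obtain ⟨a, -, rfl⟩ := hS
    exact ⟨a, rfl⟩
  root_notMem_active := by
    intro S hS
    simp only [initState, Finset.mem_image, Finset.mem_erase, Finset.mem_univ, and_true] at hS
    obtain ⟨a, ha, rfl⟩ := hS
    simpa using ha.symm
  mem_deactivated := by
    intro C hC hr hCa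
    simp only [initState, Finset.mem_image, Finset.mem_erase, Finset.mem_univ, and_true,
      true_and] at hC hCa
    obtain ⟨a, rfl⟩ := hC
    exact absurd ⟨a, fun h => hr (by simp [h]), rfl⟩ hCa
  y_nonneg := by simp [initState]
  y_support := by simp [initState]
  edgeLoad_le := by
    intro e he
    simpa [edgeLoad, initState] using hcost e (P.mem_edges.1 he)
  penLoad_le := by
    intro X _
    simpa [penLoad, initState, pen] using Finset.sum_nonneg fun v _ => hpen v
  root_notMem_deactivated := by simp [initState]
  deactivated_sub := by simp [initState]
  deactivated_tight := by simp [initState]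
  deactivated_notMem_active := by simp [initState]
  laminar := by simp [initState]
  F_edges := by simp [initState]
  F_tight := by simp [initState]
  F_inside := by simp [initState]
  reachable := by
    intro C hC u hu v hv
    simp only [initState, Finset.mem_image, Finset.mem_univ, true_and] at hC
    obtain ⟨a, rfl⟩ := hC
    rw [Finset.mem_singleton.1 hu, Finset.mem_singleton.1 hv]
  acyclic := by simp [initState]

/-! ### Preservation of the invariants by a phase. -/

variable {P} {s : GrowState V}

theorem Valid.eq_of_subset (hs : P.Valid s) {C C' : Finset V} (hC : C ∈ s.comps)
    (hC' : C' ∈ s.comps) (h : C ⊆ C') : C = C' := by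
  obtain ⟨v, hv⟩ := hs.nonempty C hC
  exact hs.eq_of_mem C hC C' hC' v hv (h hv)

theorem Valid.raise_nonneg (hs : P.Valid s) {Δ : ℝ} (hΔ : 0 ≤ Δ) (S : Finset V) :
    0 ≤ s.raise Δ S := by
  have := hs.y_nonneg S
  unfold GrowState.raise
  split_ifs <;> linarith

theorem Valid.raise_support (hs : P.Valid s) {Δ : ℝ} {S : Finset V} (h : s.raise Δ S ≠ 0) :
    S.Nonempty ∧ P.root ∉ S ∧ ∃ C ∈ s.comps, S ⊆ C := by
  by_cases hS : S ∈ s.active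
  · exact ⟨hs.nonempty S (hs.active_comps S hS), hs.root_notMem_active S hS, S,
      hs.active_comps S hS, subset_rfl⟩
  · exact hs.y_support S (by simpa [GrowState.raise, hS] using h)

theorem penLoad_congr {y y' : Finset V → ℝ} {X : Finset V} (h : ∀ S ⊆ X, y S = y' S) :
    P.penLoad y X = P.penLoad y' X :=
  Finset.sum_congr rfl fun R hR => by rw [h R (Finset.mem_filter.1 hR).2]

theorem edgeLoad_congr {y y' : Finset V → ℝ} {e : Sym2 V} (h : ∀ S, Crosses S e → y S = y' S) :
    P.edgeLoad y e = P.edgeLoad y' e :=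
  Finset.sum_congr rfl fun S hS => h S (Finset.mem_filter.1 hS).2

omit [Fintype V] in
theorem raise_of_notMem {Δ : ℝ} {S : Finset V} (h : S ∉ s.active) : s.raise Δ S = s.y S := by
  simp [GrowState.raise, h]

/-- The penalty constraints decompose along the partition. -/
theorem Valid.penLoad_le_of_comps (hs : P.Valid s) {y : Finset V → ℝ}
    (hy : ∀ S, y S ≠ 0 → S.Nonempty ∧ P.root ∉ S ∧ ∃ C ∈ s.comps, S ⊆ C) {X : Finset V}
    (hX : ∀ C ∈ s.comps, P.penLoad y (X ∩ C) ≤ P.pen (X ∩ C)) :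
    P.penLoad y X ≤ P.pen X := by
  -- Every set in the support of `y` is nonempty and lies in one block, so it is counted for exactly
  -- one `C`.
  have h1 : P.penLoad y X = ∑ C ∈ s.comps, P.penLoad y (X ∩ C) := by
    simp only [penLoad, Finset.sum_filter]
    rw [Finset.sum_comm]
    refine Finset.sum_congr rfl fun R _ => ?_
    by_cases hR : y R = 0
    · simp [hR]
    · obtain ⟨⟨v, hv⟩, -, C, hC, hRC⟩ := hy R hR
      rw [Finset.sum_eq_single C]
      · simp [Finset.subset_inter_iff, hRC]
      · intro C' hC' hne
        rw [if_neg]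
        intro h
        exact hne (hs.eq_of_mem C' hC' C hC v ((Finset.subset_inter_iff.1 h).2 hv) (hRC hv))
      · exact fun h => absurd hC h
  have h2 : P.pen X = ∑ C ∈ s.comps, P.pen (X ∩ C) := by
    have : ∀ C, P.pen (X ∩ C) = ∑ v ∈ X, if v ∈ C then P.penalty v else 0 := fun C => by
      rw [pen, ← Finset.filter_mem_eq_inter, Finset.sum_filter]
    simp only [this]
    rw [Finset.sum_comm]
    refine Finset.sum_congr rfl fun v _ => ?_
    obtain ⟨C, hC, hv⟩ := hs.cover v
    rw [Finset.sum_eq_single C]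
    · simp [hv]
    · intro C' hC' hne
      rw [if_neg]
      exact fun h => hne (hs.eq_of_mem C' hC' C hC v h hv)
    · exact fun h => absurd hC h
  rw [h1, h2]
  exact Finset.sum_le_sum hX

/-- `CanRaise` checks penalties only for active sets, but this suffices for all `X`: unless the
block `C` is active and contained in `X`, no active set lies in `X ∩ C` and its load does not
change. Chosen edges and deactivated sets keep their loads because active sets are whole blocks. -/
theorem Valid.raise (hs : P.Valid s) {Δ : ℝ} (h : P.CanRaise s Δ) :
    P.Valid { s with y := s.raise Δ } where
  cover := hs.cover
  eq_of_mem := hs.eq_of_mem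
  nonempty := hs.nonempty
  active_comps := hs.active_comps
  root_notMem_active := hs.root_notMem_active
  mem_deactivated := hs.mem_deactivated
  y_nonneg := hs.raise_nonneg h.2.1
  y_support _ := hs.raise_support
  edgeLoad_le := h.2.2.1
  penLoad_le X hX := by
    refine hs.penLoad_le_of_comps (fun _ => hs.raise_support) fun C hC => ?_
    by_cases hCX : C ∈ s.active ∧ C ⊆ X
    · rw [Finset.inter_eq_right.2 hCX.2]
      exact h.2.2.2 C hCX.1
    · rw [penLoad_congr (y' := s.y)]
      · exact hs.penLoad_le _ fun h => hX (Finset.mem_inter.1 h).1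
      · intro S hS
        refine raise_of_notMem fun hSa => hCX ?_
        obtain ⟨h1, h2⟩ := Finset.subset_inter_iff.1 hS
        have := hs.eq_of_subset (hs.active_comps S hSa) hC h2
        subst this
        exact ⟨hSa, h1⟩
  root_notMem_deactivated := hs.root_notMem_deactivated
  deactivated_sub := hs.deactivated_sub
  deactivated_tight X hX := by
    rw [← hs.deactivated_tight X hX]
    refine penLoad_congr fun S hS => raise_of_notMem fun hSa => ?_
    obtain ⟨C, hC, hXC⟩ := hs.deactivated_sub X hX
    have := hs.eq_of_subset (hs.active_comps S hSa) hC (hS.trans hXC)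
    subst this
    exact hs.deactivated_notMem_active X hX (hXC.antisymm hS ▸ hSa)
  deactivated_notMem_active := hs.deactivated_notMem_active
  laminar := hs.laminar
  F_edges := hs.F_edges
  F_tight e he := by
    rw [← hs.F_tight e he]
    refine edgeLoad_congr fun S hS => raise_of_notMem fun hSa => ?_
    obtain ⟨C, hC, heC⟩ := hs.F_inside e he
    obtain ⟨u, hu, v, hv, rfl⟩ := hS
    have := hs.eq_of_mem S (hs.active_comps S hSa) C hC u hu (heC u (by simp))
    exact hv (this ▸ heC v (by simp))
  F_inside := hs.F_inside
  reachable := hs.reachable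
  acyclic := hs.acyclic

/-- The configuration after an active set has been made inactive. -/
noncomputable abbrev afterDeactivate (s : GrowState V) (S : Finset V) : GrowState V :=
  { comps := s.comps
    active := s.active.erase S
    deactivated := insert S s.deactivated
    y := s.y
    F := s.F }

variable (P) in
/-- The configuration after the sets `A` and `B` have been merged along the edge `e`. -/
noncomputable abbrev afterMerge (s : GrowState V) (A B : Finset V) (e : Sym2 V) : GrowState V :=
  { comps := insert (A ∪ B) ((s.comps.erase A).erase B)
    active :=
      if P.root ∈ A ∪ B then (s.active.erase A).erase B
      else insert (A ∪ B) ((s.active.erase A).erase B)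
    deactivated := s.deactivated
    y := s.y
    F := insert e s.F }

theorem Valid.deactivate (hs : P.Valid s) {S : Finset V} (hS : S ∈ s.active)
    (htight : P.penLoad s.y S = P.pen S) : P.Valid (afterDeactivate s S) where
  cover := hs.cover
  eq_of_mem := hs.eq_of_mem
  nonempty := hs.nonempty
  active_comps S' hS' := hs.active_comps S' (Finset.mem_of_mem_erase hS')
  root_notMem_active S' hS' := hs.root_notMem_active S' (Finset.mem_of_mem_erase hS')
  mem_deactivated C hC hr hCa := by
    by_cases h : C = S
    · exact Finset.mem_insert.2 (Or.inl h)
    · exact Finset.mem_insert_of_mem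
        (hs.mem_deactivated C hC hr fun h' => hCa (Finset.mem_erase.2 ⟨h, h'⟩))
  y_nonneg := hs.y_nonneg
  y_support := hs.y_support
  edgeLoad_le := hs.edgeLoad_le
  penLoad_le := hs.penLoad_le
  root_notMem_deactivated X hX := by
    rcases Finset.mem_insert.1 hX with rfl | h
    · exact hs.root_notMem_active _ hS
    · exact hs.root_notMem_deactivated X h
  deactivated_sub X hX := by
    rcases Finset.mem_insert.1 hX with rfl | h
    · exact ⟨X, hs.active_comps _ hS, subset_rfl⟩
    · exact hs.deactivated_sub X h
  deactivated_tight X hX := by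
    rcases Finset.mem_insert.1 hX with rfl | h
    · exact htight
    · exact hs.deactivated_tight X h
  deactivated_notMem_active X hX := by
    rcases Finset.mem_insert.1 hX with rfl | h
    · exact Finset.notMem_erase _ _
    · exact fun h' => hs.deactivated_notMem_active X h (Finset.mem_of_mem_erase h')
  laminar := by
    -- `S` is a block, and every earlier deactivated set lies within one block.
    have key : ∀ X ∈ s.deactivated, X ⊆ S ∨ Disjoint X S := by
      intro X hX
      obtain ⟨C, hC, hXC⟩ := hs.deactivated_sub X hX
      by_cases h : C = S
      · exact Or.inl (h ▸ hXC)
      · exact Or.inr (Finset.disjoint_left.2 fun v hv hvS =>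
          h (hs.eq_of_mem C hC S (hs.active_comps S hS) v (hXC hv) hvS))
    intro X hX X' hX'
    rcases Finset.mem_insert.1 hX with rfl | h <;> rcases Finset.mem_insert.1 hX' with rfl | h'
    · exact Or.inl subset_rfl
    · rcases key X' h' with h | h
      · exact Or.inr (Or.inl h)
      · exact Or.inr (Or.inr h.symm)
    · rcases key X h with h | h
      · exact Or.inl h
      · exact Or.inr (Or.inr h)
    · exact hs.laminar X h X' h'
  F_edges := hs.F_edges
  F_tight := hs.F_tight
  F_inside := hs.F_inside
  reachable := hs.reachable
  acyclic := hs.acyclic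

omit [Fintype V] in
theorem mem_afterMerge_comps {A B C : Finset V} {e : Sym2 V} :
    C ∈ (P.afterMerge s A B e).comps ↔ C = A ∪ B ∨ C ≠ B ∧ C ≠ A ∧ C ∈ s.comps := by
  simp

omit [Fintype V] in
theorem mem_afterMerge_active {A B S : Finset V} {e : Sym2 V} :
    S ∈ (P.afterMerge s A B e).active ↔
      (S = A ∪ B ∧ P.root ∉ A ∪ B) ∨ S ≠ B ∧ S ≠ A ∧ S ∈ s.active := by
  unfold afterMerge
  dsimp only
  by_cases h : P.root ∈ A ∪ B
  · rw [if_pos h]; simp only [Finset.mem_erase]; tauto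
  · rw [if_neg h]; simp only [Finset.mem_insert, Finset.mem_erase]; tauto

omit [Fintype V] in
theorem exists_afterMerge_comps_supset {A B C : Finset V} {e : Sym2 V} (hC : C ∈ s.comps) :
    ∃ C' ∈ (P.afterMerge s A B e).comps, C ⊆ C' := by
  by_cases hA : C = A
  · exact ⟨A ∪ B, mem_afterMerge_comps.2 (Or.inl rfl), hA ▸ Finset.subset_union_left⟩
  by_cases hB : C = B
  · exact ⟨A ∪ B, mem_afterMerge_comps.2 (Or.inl rfl), hB ▸ Finset.subset_union_right⟩
  exact ⟨C, mem_afterMerge_comps.2 (Or.inr ⟨hB, hA, hC⟩), subset_rfl⟩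

theorem Valid.mem_of_reachable (hs : P.Valid s) {C : Finset V} (hC : C ∈ s.comps) {u v : V}
    (h : (SimpleGraph.fromEdgeSet (s.F : Set (Sym2 V))).Reachable u v) (hu : u ∈ C) : v ∈ C := by
  by_contra hv
  obtain ⟨e, he, a, ha, b, hb, rfl⟩ := exists_crosses_of_reachable h hu hv
  obtain ⟨C', hC', hin⟩ := hs.F_inside _ (by simpa using he)
  rw [hs.eq_of_mem C hC C' hC' a ha (hin a (by simp))] at hb
  exact hb (hin b (by simp))

theorem Valid.merge (hs : P.Valid s) {A B : Finset V} {u v : V} (hA : A ∈ s.active)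
    (hB : B ∈ s.comps) (hAB : A ≠ B) (hu : u ∈ A) (hv : v ∈ B) (he : s(u, v) ∈ P.edges)
    (htight : P.edgeLoad s.y s(u, v) = P.cost s(u, v)) :
    P.Valid (P.afterMerge s A B s(u, v)) := by
  have hAc := hs.active_comps A hA
  have hdisj : ∀ C ∈ s.comps, C ≠ A → C ≠ B → ∀ w ∈ C, w ∉ A ∪ B := by
    intro C hC h1 h2 w hw hw'
    rcases Finset.mem_union.1 hw' with h | h
    · exact h1 (hs.eq_of_mem C hC A hAc w hw h)
    · exact h2 (hs.eq_of_mem C hC B hB w hw h)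
  -- Hence `A ∪ B` is new: it cannot have been deactivated before.
  have hnotsub : ∀ C ∈ s.comps, ¬ A ∪ B ⊆ C := by
    intro C hC h
    have h1 := hs.eq_of_mem A hAc C hC u hu (h (Finset.mem_union_left _ hu))
    have h2 := hs.eq_of_mem B hB C hC v hv (h (Finset.mem_union_right _ hv))
    exact hAB (h1.trans h2.symm)
  have hvA : v ∉ A := fun h => hAB (hs.eq_of_mem A hAc B hB v h hv)
  have huv : u ≠ v := fun h => hvA (h ▸ hu)
  have hgraph : SimpleGraph.fromEdgeSet ((insert s(u, v) s.F : Finset (Sym2 V)) : Set (Sym2 V)) =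
      SimpleGraph.fromEdgeSet (s.F : Set (Sym2 V)) ⊔ SimpleGraph.edge u v := by
    rw [SimpleGraph.edge, Finset.coe_insert, Set.insert_eq, Set.union_comm,
      SimpleGraph.fromEdgeSet_union]
  have hmono : SimpleGraph.fromEdgeSet (s.F : Set (Sym2 V)) ≤
      SimpleGraph.fromEdgeSet ((insert s(u, v) s.F : Finset (Sym2 V)) : Set (Sym2 V)) :=
    SimpleGraph.fromEdgeSet_mono (by simp)
  refine
  { cover := fun w => ?_
    eq_of_mem := ?_
    nonempty := ?_
    active_comps := ?_
    root_notMem_active := ?_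
    mem_deactivated := ?_
    y_nonneg := hs.y_nonneg
    y_support := fun S hS => ?_
    edgeLoad_le := hs.edgeLoad_le
    penLoad_le := hs.penLoad_le
    root_notMem_deactivated := hs.root_notMem_deactivated
    deactivated_sub := fun X hX => ?_
    deactivated_tight := hs.deactivated_tight
    deactivated_notMem_active := fun X hX h => ?_
    laminar := hs.laminar
    F_edges := fun e he' => ?_
    F_tight := fun e he' => ?_
    F_inside := fun e he' => ?_
    reachable := ?_
    acyclic := ?_ }
  · obtain ⟨C, hC, hw⟩ := hs.cover w
    obtain ⟨C', hC', hsub⟩ := exists_afterMerge_comps_supset (P := P) (A := A) (B := B)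
      (e := s(u, v)) hC
    exact ⟨C', hC', hsub hw⟩
  · intro C hC C' hC' w hw hw'
    rcases mem_afterMerge_comps.1 hC with rfl | ⟨h1, h2, h3⟩ <;>
      rcases mem_afterMerge_comps.1 hC' with rfl | ⟨h1', h2', h3'⟩
    · rfl
    · exact absurd hw (hdisj C' h3' h2' h1' w hw')
    · exact absurd hw' (hdisj C h3 h2 h1 w hw)
    · exact hs.eq_of_mem C h3 C' h3' w hw hw'
  · intro C hC
    rcases mem_afterMerge_comps.1 hC with rfl | ⟨h1, h2, h3⟩
    · exact ⟨u, Finset.mem_union_left _ hu⟩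
    · exact hs.nonempty C h3
  · intro S hS
    rw [mem_afterMerge_active] at hS
    rw [mem_afterMerge_comps]
    rcases hS with ⟨h, -⟩ | ⟨h1, h2, h3⟩
    · exact Or.inl h
    · exact Or.inr ⟨h1, h2, hs.active_comps S h3⟩
  · intro S hS
    rw [mem_afterMerge_active] at hS
    rcases hS with ⟨rfl, h⟩ | ⟨h1, h2, h3⟩
    · exact h
    · exact hs.root_notMem_active S h3
  · intro C hC hr hCa
    rw [mem_afterMerge_active] at hCa
    rcases mem_afterMerge_comps.1 hC with rfl | ⟨h1, h2, h3⟩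
    · exact absurd (Or.inl ⟨rfl, hr⟩) hCa
    · exact hs.mem_deactivated C h3 hr fun h => hCa (Or.inr ⟨h1, h2, h⟩)
  · obtain ⟨h1, h2, C, hC, h3⟩ := hs.y_support S hS
    obtain ⟨C', hC', hsub⟩ := exists_afterMerge_comps_supset (P := P) (A := A) (B := B)
      (e := s(u, v)) hC
    exact ⟨h1, h2, C', hC', h3.trans hsub⟩
  · obtain ⟨C, hC, h3⟩ := hs.deactivated_sub X hX
    obtain ⟨C', hC', hsub⟩ := exists_afterMerge_comps_supset (P := P) (A := A) (B := B)
      (e := s(u, v)) hC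
    exact ⟨C', hC', h3.trans hsub⟩
  · rw [mem_afterMerge_active] at h
    rcases h with ⟨rfl, -⟩ | ⟨h1, h2, h3⟩
    · obtain ⟨C, hC, h⟩ := hs.deactivated_sub _ hX
      exact hnotsub C hC h
    · exact hs.deactivated_notMem_active X hX h3
  · rcases Finset.mem_insert.1 he' with rfl | h
    · exact he
    · exact hs.F_edges e h
  · rcases Finset.mem_insert.1 he' with rfl | h
    · exact htight
    · exact hs.F_tight e h
  · rcases Finset.mem_insert.1 he' with rfl | h
    · refine ⟨A ∪ B, mem_afterMerge_comps.2 (Or.inl rfl), fun w hw => ?_⟩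
      rcases Sym2.mem_iff.1 hw with rfl | rfl
      · exact Finset.mem_union_left _ hu
      · exact Finset.mem_union_right _ hv
    · obtain ⟨C, hC, h3⟩ := hs.F_inside e h
      obtain ⟨C', hC', hsub⟩ := exists_afterMerge_comps_supset (P := P) (A := A) (B := B)
        (e := s(u, v)) hC
      exact ⟨C', hC', fun w hw => hsub (h3 w hw)⟩
  · intro C hC a ha b hb
    rcases mem_afterMerge_comps.1 hC with rfl | ⟨h1, h2, h3⟩
    · have huv' : (SimpleGraph.fromEdgeSet
          ((insert s(u, v) s.F : Finset (Sym2 V)) : Set (Sym2 V))).Reachable u v :=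
        SimpleGraph.Adj.reachable ((SimpleGraph.fromEdgeSet_adj _).2 ⟨by simp, huv⟩)
      have key : ∀ w ∈ A ∪ B, (SimpleGraph.fromEdgeSet
          ((insert s(u, v) s.F : Finset (Sym2 V)) : Set (Sym2 V))).Reachable u w := by
        intro w hw
        rcases Finset.mem_union.1 hw with h | h
        · exact (hs.reachable A hAc u hu w h).mono hmono
        · exact huv'.trans ((hs.reachable B hB v hv w h).mono hmono)
      exact (key a ha).symm.trans (key b hb)
    · exact (hs.reachable C h3 a ha b hb).mono hmono
  · change (SimpleGraph.fromEdgeSet ((insert s(u, v) s.F : Finset (Sym2 V)) : Set (Sym2 V))).IsAcyclic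
    rw [hgraph]
    -- Chosen edges never leave a block, so `u` and `v` were not connected before.
    exact hs.acyclic.sup_edge_of_not_reachable fun h => hvA (hs.mem_of_reachable hAc h hu)

theorem Valid.phase {s' : GrowState V} (hs : P.Valid s) (h : P.Phase s s') : P.Valid s' := by
  cases h with
  | merge Δ A B u v hraise hA hB hAB hu hv he htight =>
    exact (hs.raise hraise).merge hA hB hAB hu hv he htight
  | deactivate Δ S hraise hS htight => exact (hs.raise hraise).deactivate hS htight

theorem Run.valid (hcost : ∀ e ∈ P.graph.edgeSet, 0 ≤ P.cost e) (hpen : ∀ v, 0 ≤ P.penalty v)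
    {n : ℕ} (h : P.Run n s) : P.Valid s := by
  induction h with
  | init => exact P.valid_initState hcost hpen
  | phase _ hphase ih => exact ih.phase hphase

theorem Valid.dualFeasible (hs : P.Valid s) : P.DualFeasible s.y :=
  ⟨hs.edgeLoad_le, hs.penLoad_le, fun S _ => hs.y_nonneg S⟩

/-! ### Progress and termination -/

/-- The potential `|comps| + |active|` drops in every phase: a merge loses a block and gains no
active set, a deactivation loses an active set. The `+ 1` reflects that the root singleton is not
active at the start. -/
theorem Run.add_card_le (hcost : ∀ e ∈ P.graph.edgeSet, 0 ≤ P.cost e)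
    (hpen : ∀ v, 0 ≤ P.penalty v) {n : ℕ} (h : P.Run n s) :
    n + (s.comps.card + s.active.card) + 1 ≤ 2 * Fintype.card V := by
  induction h with
  | init =>
    have h1 : P.initState.comps.card ≤ Fintype.card V := Finset.card_image_le
    have h2 : P.initState.active.card ≤ (Finset.univ.erase P.root).card := Finset.card_image_le
    have h3 := Finset.card_erase_add_one (Finset.mem_univ P.root)
    rw [Finset.card_univ] at h3
    omega
  | @phase n s s' hrun hphase ih =>
    have hs := hrun.valid hcost hpen
    cases hphase with
    | merge Δ A B u v hraise hA hB hAB hu hv he htight =>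
      have h1 : (insert (A ∪ B) ((s.comps.erase A).erase B)).card + 1 ≤ s.comps.card := by
        have := Finset.card_insert_le (A ∪ B) ((s.comps.erase A).erase B)
        have h2 := Finset.card_erase_add_one (hs.active_comps A hA)
        have h3 := Finset.card_erase_add_one (Finset.mem_erase.2 ⟨hAB.symm, hB⟩)
        omega
      have h2 : (if P.root ∈ A ∪ B then (s.active.erase A).erase B
          else insert (A ∪ B) ((s.active.erase A).erase B)).card ≤ s.active.card := by
        have h1 := Finset.card_insert_le (A ∪ B) ((s.active.erase A).erase B)
        have h2 := Finset.card_erase_add_one hA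
        have h3 := Finset.card_erase_le (s := s.active.erase A) (a := B)
        split_ifs <;> omega
      dsimp only
      omega
    | deactivate Δ S hraise hS htight =>
      have := Finset.card_erase_add_one hS
      dsimp only
      omega

theorem Run.le (hcost : ∀ e ∈ P.graph.edgeSet, 0 ≤ P.cost e)
    (hpen : ∀ v, 0 ≤ P.penalty v) {n : ℕ} (h : P.Run n s) : n ≤ 2 * Fintype.card V - 2 := by
  have h1 := h.add_card_le hcost hpen
  obtain ⟨C, hC, -⟩ := (h.valid hcost hpen).cover P.root
  have := Finset.card_pos.2 ⟨C, hC⟩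
  omega

/-- Finitely many affine constraints that hold at `0`, of which some are increasing, hold up to
the first moment at which an increasing one becomes tight. -/
theorem exists_first_tight {ι : Type*} (t : Finset ι) (a k b : ι → ℝ) (hab : ∀ i ∈ t, a i ≤ b i)
    (hk : ∀ i ∈ t, 0 ≤ k i) (hpos : ∃ i ∈ t, 0 < k i) :
    ∃ Δ, 0 ≤ Δ ∧ (∀ i ∈ t, a i + k i * Δ ≤ b i) ∧ ∃ i ∈ t, 0 < k i ∧ a i + k i * Δ = b i := by
  obtain ⟨i₀, hi₀, hki₀⟩ := hpos
  obtain ⟨i, hi, hmin⟩ := Finset.exists_min_image (t.filter fun i => 0 < k i)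
    (fun i => (b i - a i) / k i) ⟨i₀, by simp [hi₀, hki₀]⟩
  obtain ⟨hi, hki⟩ := Finset.mem_filter.1 hi
  refine ⟨(b i - a i) / k i, div_nonneg (by linarith [hab i hi]) hki.le, fun j hj => ?_, i, hi, hki,
    by field_simp; ring⟩
  rcases (hk j hj).eq_or_lt with h | h
  · rw [← h]; linarith [hab j hj]
  · have := hmin j (by simp [hj, h])
    rw [le_div_iff₀ h] at this
    linarith

theorem Valid.active_mem (hs : P.Valid s) {S : Finset V} (hS : S ∈ s.active) :
    S ∈ P.oddSets ∪ P.evenSets :=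
  P.mem_oddSets_union_evenSets.2
    ⟨hs.root_notMem_active S hS, hs.nonempty S (hs.active_comps S hS)⟩

theorem edgeLoad_raise (hs : P.Valid s) (Δ : ℝ) (e : Sym2 V) :
    P.edgeLoad (s.raise Δ) e =
      P.edgeLoad s.y e + ((s.active.filter fun S => Crosses S e).card : ℝ) * Δ := by
  have : s.active.filter (fun S => Crosses S e) =
      ((P.oddSets ∪ P.evenSets).filter fun S => Crosses S e).filter fun S => S ∈ s.active := by
    ext S
    simp only [Finset.mem_filter]
    exact ⟨fun h => ⟨⟨hs.active_mem h.1, h.2⟩, h.1⟩, fun h => ⟨h.2, h.1.2⟩⟩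
  simp only [edgeLoad, GrowState.raise]
  rw [Finset.sum_add_distrib, this, ← Finset.sum_filter, Finset.sum_const, nsmul_eq_mul]

theorem penLoad_raise (s : GrowState V) (Δ : ℝ) (X : Finset V) :
    P.penLoad (s.raise Δ) X = P.penLoad s.y X +
      2 * (((P.evenSets.filter fun R => R ⊆ X).filter fun S => S ∈ s.active).card : ℝ) * Δ := by
  simp only [penLoad, GrowState.raise, mul_add]
  rw [Finset.sum_add_distrib, ← Finset.mul_sum, ← Finset.mul_sum,
    ← Finset.sum_filter, Finset.sum_const, nsmul_eq_mul]
  ring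

theorem exists_crossing_edge (hconn : P.graph.Connected) {S : Finset V} (hS : S.Nonempty)
    (hr : P.root ∉ S) : ∃ e ∈ P.edges, Crosses S e := by
  obtain ⟨v, hv⟩ := hS
  have h := hconn.preconnected v P.root
  rw [← P.graph.fromEdgeSet_edgeSet] at h
  obtain ⟨e, he, hc⟩ := exists_crosses_of_reachable h hv hr
  exact ⟨e, P.mem_edges.2 he, hc⟩

/-- All relevant loads are affine in `Δ`. By connectivity some edge leaves an active set, so its
load grows and a first tight moment exists. A tight edge whose load grows is crossed by an active
set, so a merge along it is possible. -/
theorem Valid.exists_phase (hs : P.Valid s) (hconn : P.graph.Connected)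
    (h : s.active.Nonempty) : ∃ s', P.Phase s s' := by
  obtain ⟨S₀, hS₀⟩ := h
  let t : Finset (Sym2 V ⊕ Finset V) := P.edges.disjSum s.active
  let a : Sym2 V ⊕ Finset V → ℝ := Sum.elim (P.edgeLoad s.y) (P.penLoad s.y)
  let k : Sym2 V ⊕ Finset V → ℝ := Sum.elim
    (fun e => ((s.active.filter fun S => Crosses S e).card : ℝ))
    (fun X => 2 * (((P.evenSets.filter fun R => R ⊆ X).filter fun S => S ∈ s.active).card : ℝ))
  let b : Sym2 V ⊕ Finset V → ℝ := Sum.elim P.cost P.pen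
  obtain ⟨e₀, he₀, hc₀⟩ := exists_crossing_edge hconn (hs.nonempty S₀ (hs.active_comps S₀ hS₀))
    (hs.root_notMem_active S₀ hS₀)
  obtain ⟨Δ, hΔ, hle, i, hi, hki, heq⟩ := exists_first_tight t a k b
    (by
      rintro (e | X) hi
      · exact hs.edgeLoad_le e (by simpa [t] using hi)
      · exact hs.penLoad_le X (hs.root_notMem_active X (by simpa [t] using hi)))
    (by
      rintro (e | X) _ <;> simp [k])
    ⟨Sum.inl e₀, by simpa [t] using he₀, by
      simp only [k, Sum.elim_inl, Nat.cast_pos, Finset.card_pos]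
      exact ⟨S₀, Finset.mem_filter.2 ⟨hS₀, hc₀⟩⟩⟩
  have hcan : P.CanRaise s Δ := by
    refine ⟨⟨S₀, hS₀⟩, hΔ, fun e he => ?_, fun S hS => ?_⟩
    · rw [edgeLoad_raise hs]
      exact hle (Sum.inl e) (by simpa [t] using he)
    · rw [penLoad_raise]
      exact hle (Sum.inr S) (by simpa [t] using hS)
  rcases i with e | X
  · have he : e ∈ P.edges := by simpa [t] using hi
    simp only [k, Sum.elim_inl, Nat.cast_pos, Finset.card_pos] at hki
    obtain ⟨A, hAmem⟩ := hki
    obtain ⟨hA, u, hu, v, hv, rfl⟩ := Finset.mem_filter.1 hAmem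
    obtain ⟨B, hB, hvB⟩ := hs.cover v
    refine ⟨_, Phase.merge s Δ A B u v hcan hA hB (fun h => hv (h ▸ hvB)) hu hvB he ?_⟩
    rw [edgeLoad_raise hs]
    exact heq
  · refine ⟨_, Phase.deactivate s Δ X hcan (by simpa [t] using hi) ?_⟩
    rw [penLoad_raise]
    exact heq

theorem exists_run_active_eq_empty (hconn : P.graph.Connected)
    (hcost : ∀ e ∈ P.graph.edgeSet, 0 ≤ P.cost e) (hpen : ∀ v, 0 ≤ P.penalty v) :
    ∃ n s, P.Run n s ∧ s.active = ∅ := by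
  by_contra! hcon
  have : ∀ n, ∃ s, P.Run n s := by
    intro n
    induction n with
    | zero => exact ⟨_, Run.init⟩
    | succ n ih =>
      obtain ⟨s, hs⟩ := ih
      obtain ⟨s', hs'⟩ := (hs.valid hcost hpen).exists_phase hconn (hcon n s hs)
      exact ⟨s', hs.phase hs'⟩
  obtain ⟨s, hs⟩ := this (2 * Fintype.card V)
  have := hs.add_card_le hcost hpen
  omega

end PCInstance

namespace PCInstance

variable {V : Type*} [Fintype V] {P : PCInstance V} {s : GrowState V}

/-! ### Sets of large penalty are never deactivated -/

/-- Every dual set is crossed by an edge, so the total of `y` is at most the total load of the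
edges, hence at most `c(E)`. No penalty load exceeds `2c(E)`, so a set containing a node of `T` is
never `π`-tight. -/
theorem Valid.disjoint_T (hs : P.Valid s) (hconn : P.graph.Connected)
    (hpen : ∀ v, 0 ≤ P.penalty v)
    (hlarge : ∀ t ∈ P.T, 2 * ∑ e ∈ P.edges, P.cost e < P.penalty t)
    {X : Finset V} (hX : X ∈ s.deactivated) : Disjoint X P.T := by
  rw [Finset.disjoint_left]
  intro t htX htT
  have h1 : P.penalty t ≤ P.pen X := Finset.single_le_sum (fun v _ => hpen v) htX
  have h2 : P.penLoad s.y X ≤ 2 * ∑ S ∈ P.oddSets ∪ P.evenSets, s.y S := by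
    rw [penLoad, ← Finset.mul_sum]
    refine mul_le_mul_of_nonneg_left ?_ (by norm_num)
    refine Finset.sum_le_sum_of_subset_of_nonneg ?_ fun S _ _ => hs.y_nonneg S
    exact (Finset.filter_subset _ _).trans Finset.subset_union_right
  have h3 : ∑ S ∈ P.oddSets ∪ P.evenSets, s.y S ≤ ∑ e ∈ P.edges, P.edgeLoad s.y e := by
    rw [sum_edgeLoad]
    refine Finset.sum_le_sum fun S hS => ?_
    obtain ⟨hr, hne⟩ := P.mem_oddSets_union_evenSets.1 hS
    obtain ⟨e, he, hc⟩ := exists_crossing_edge hconn hne hr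
    have hpos := Finset.card_pos.2 ⟨e, mem_cutIn.2 ⟨he, hc⟩⟩
    exact le_mul_of_one_le_right (hs.y_nonneg S) (by exact_mod_cast hpos)
  have h4 : ∑ e ∈ P.edges, P.edgeLoad s.y e ≤ ∑ e ∈ P.edges, P.cost e :=
    Finset.sum_le_sum hs.edgeLoad_le
  have h5 := hs.deactivated_tight X hX
  have h6 := hlarge t htT
  linarith

/-! ### Unions of tight sets -/

/-- Uncrossing: `penLoad` is supermodular and `pen` is modular, so feasibility for the union and the
intersection forces equality. -/
theorem Valid.penLoad_union (hs : P.Valid s) {A B : Finset V} (hA : P.root ∉ A) (hB : P.root ∉ B)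
    (hA' : P.penLoad s.y A = P.pen A) (hB' : P.penLoad s.y B = P.pen B) :
    P.penLoad s.y (A ∪ B) = P.pen (A ∪ B) := by
  have h1 : P.penLoad s.y A + P.penLoad s.y B ≤
      P.penLoad s.y (A ∪ B) + P.penLoad s.y (A ∩ B) := by
    simp only [penLoad, Finset.sum_filter]
    rw [← Finset.sum_add_distrib, ← Finset.sum_add_distrib]
    refine Finset.sum_le_sum fun R _ => ?_
    have := hs.y_nonneg R
    by_cases h1 : R ⊆ A
    · by_cases h2 : R ⊆ B
      · simp [h1, h2, Finset.subset_inter_iff, h1.trans Finset.subset_union_left]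
      · simp [h1, h2, Finset.subset_inter_iff, h1.trans Finset.subset_union_left]
    · by_cases h2 : R ⊆ B
      · simp [h1, h2, Finset.subset_inter_iff, h2.trans Finset.subset_union_right]
      · simp only [h1, h2, Finset.subset_inter_iff, if_false, false_and, add_zero]
        split_ifs <;> linarith
  have h2 : P.pen (A ∪ B) + P.pen (A ∩ B) = P.pen A + P.pen B := Finset.sum_union_inter
  have h3 := hs.penLoad_le (A ∪ B) (by simp [hA, hB])
  have h4 := hs.penLoad_le (A ∩ B) (by simp [hA])
  linarith

theorem Valid.penLoad_biUnion (hs : P.Valid s) {𝒳 : Finset (Finset V)} (h : 𝒳 ⊆ s.deactivated) :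
    P.root ∉ 𝒳.biUnion id ∧ P.penLoad s.y (𝒳.biUnion id) = P.pen (𝒳.biUnion id) := by
  induction 𝒳 using Finset.induction_on with
  | empty =>
    refine ⟨by simp, ?_⟩
    rw [Finset.biUnion_empty, pen, Finset.sum_empty, penLoad]
    refine Finset.sum_eq_zero fun R hR => ?_
    obtain ⟨h1, h2⟩ := Finset.mem_filter.1 hR
    exact absurd (Finset.subset_empty.1 h2) (P.mem_evenSets.1 h1).2.1.ne_empty
  | insert X 𝒳 _ ih =>
    obtain ⟨ih1, ih2⟩ := ih ((Finset.subset_insert _ _).trans h)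
    have hX := h (Finset.mem_insert_self X 𝒳)
    have hr := hs.root_notMem_deactivated X hX
    rw [Finset.biUnion_insert]
    exact ⟨by simpa [hr] using ih1, hs.penLoad_union hr ih1 (hs.deactivated_tight X hX) ih2⟩

/-! ### Pruning -/

section Prune

variable {W : Type*}

/-- A walk from `r` that enters `X` must enter and leave through the single edge `e`, so its
excursions into `X` can be cut out. -/
theorem reachable_erase_iff {F : Finset (Sym2 W)} {X : Finset W} {e : Sym2 W} {r v : W}
    (hcut : cutIn F X = {e}) (hr : r ∉ X) :
    (SimpleGraph.fromEdgeSet ((F.erase e : Finset (Sym2 W)) : Set (Sym2 W))).Reachable r v ↔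
      (SimpleGraph.fromEdgeSet (F : Set (Sym2 W))).Reachable r v ∧ v ∉ X := by
  have he : e ∈ cutIn F X := by simp [hcut]
  constructor
  · intro h
    refine ⟨h.mono (SimpleGraph.fromEdgeSet_mono (by simp)), fun hv => ?_⟩
    obtain ⟨f, hf, hfc⟩ := exists_crosses_of_reachable h.symm hv hr
    obtain ⟨h1, h2⟩ := Finset.mem_erase.1 (Finset.mem_coe.1 hf)
    have : f ∈ cutIn F X := mem_cutIn.2 ⟨h2, hfc⟩
    rw [hcut, Finset.mem_singleton] at this
    exact h1 this
  · rintro ⟨h, hv⟩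
    obtain ⟨a, ha, b, hb, rfl⟩ := (mem_cutIn.1 he).2
    set H := SimpleGraph.fromEdgeSet ((F.erase s(a, b) : Finset (Sym2 W)) : Set (Sym2 W))
    -- While the walk is inside `X`, the end `b` of `e` outside `X` is remembered as the point of
    -- return.
    have key : (v ∉ X → H.Reachable r v) ∧ (v ∈ X → H.Reachable r b) := by
      refine h.induct (p := fun v => (v ∉ X → H.Reachable r v) ∧ (v ∈ X → H.Reachable r b))
        ⟨fun _ => SimpleGraph.Reachable.rfl, fun h => absurd h hr⟩ ?_
      rintro x z hxz ⟨ih1, ih2⟩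
      obtain ⟨hmem, hne⟩ := (SimpleGraph.fromEdgeSet_adj _).1 hxz
      have huniq : Crosses X s(x, z) → s(x, z) = s(a, b) := fun h => by
        have : s(x, z) ∈ cutIn F X := mem_cutIn.2 ⟨by simpa using hmem, h⟩
        rwa [hcut, Finset.mem_singleton] at this
      by_cases hx : x ∈ X <;> by_cases hz : z ∈ X
      · exact ⟨fun h => absurd hz h, fun _ => ih2 hx⟩
      · refine ⟨fun _ => ?_, fun h => absurd h hz⟩
        have := huniq (crosses_mk.2 (Or.inl ⟨hx, hz⟩))
        rcases Sym2.eq_iff.1 this with ⟨rfl, rfl⟩ | ⟨rfl, rfl⟩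
        · exact ih2 hx
        · exact absurd hx hb
      · refine ⟨fun h => absurd hz h, fun _ => ?_⟩
        have := huniq (crosses_mk.2 (Or.inr ⟨hz, hx⟩))
        rcases Sym2.eq_iff.1 this with ⟨rfl, rfl⟩ | ⟨rfl, rfl⟩
        · exact absurd ha hx
        · exact ih1 hx
      · refine ⟨fun _ => (ih1 hx).trans (SimpleGraph.Adj.reachable ?_), fun h => absurd h hz⟩
        refine (SimpleGraph.fromEdgeSet_adj _).2 ⟨?_, hne⟩
        refine Finset.mem_coe.2 (Finset.mem_erase.2 ⟨fun h => ?_, by simpa using hmem⟩)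
        rcases Sym2.eq_iff.1 h with ⟨rfl, rfl⟩ | ⟨rfl, rfl⟩
        · exact hx ha
        · exact hz ha
    exact key.1 hv

theorem exists_prunesTo (𝒳 : Finset (Finset W)) (F : Finset (Sym2 W)) :
    ∃ F', PrunesTo 𝒳 F F' := by
  induction hn : F.card using Nat.strong_induction_on generalizing F with
  | _ n ih =>
    by_cases h : ∃ F'', PruneStep 𝒳 F F''
    · obtain ⟨F'', hF⟩ := h
      obtain ⟨X, hX, e, hcut, rfl⟩ := id hF
      have he : e ∈ F := (mem_cutIn.1 (by rw [hcut]; simp : e ∈ cutIn F X)).1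
      obtain ⟨F', h1, h2⟩ := ih _ (hn ▸ Finset.card_erase_lt_of_mem he) (F.erase e) rfl
      exact ⟨F', h1.head hF, h2⟩
    · exact ⟨F, .refl, fun F'' h' => h ⟨F'', h'⟩⟩

end Prune

/-- Before pruning, the blocks without the root are themselves deactivated and have no chosen edge
leaving them. A pruning step with `X` separates only nodes of `X`, and then `X` itself has an empty
cut. -/
theorem Valid.pruned (hs : P.Valid s) (hact : s.active = ∅) {F' : Finset (Sym2 V)}
    (h : Relation.ReflTransGen (PruneStep s.deactivated) s.F F') :
    F' ⊆ s.F ∧ ∀ v, ¬ (SimpleGraph.fromEdgeSet (F' : Set (Sym2 V))).Reachable P.root v →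
      ∃ X ∈ s.deactivated, v ∈ X ∧ cutIn F' X = ∅ := by
  induction h with
  | refl =>
    refine ⟨subset_rfl, fun v hv => ?_⟩
    obtain ⟨C, hC, hvC⟩ := hs.cover v
    refine ⟨C, hs.mem_deactivated C hC (fun hr => hv (hs.reachable C hC _ hr _ hvC)) (by simp [hact]),
      hvC, Finset.eq_empty_of_forall_notMem fun e he => ?_⟩
    obtain ⟨he, a, ha, b, hb, rfl⟩ := mem_cutIn.1 he
    obtain ⟨C', hC', hin⟩ := hs.F_inside _ he
    rw [hs.eq_of_mem C hC C' hC' a ha (hin a (by simp))] at hb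
    exact hb (hin b (by simp))
  | @tail F F' _ hstep ih =>
    obtain ⟨hsub, hun⟩ := ih
    obtain ⟨X, hX, e, hcut, rfl⟩ := hstep
    refine ⟨(Finset.erase_subset _ _).trans hsub, fun v hv => ?_⟩
    rw [reachable_erase_iff hcut (hs.root_notMem_deactivated X hX)] at hv
    by_cases hvX : v ∈ X
    · refine ⟨X, hX, hvX, Finset.eq_empty_of_forall_notMem fun f hf => ?_⟩
      obtain ⟨hf, hfc⟩ := mem_cutIn.1 hf
      obtain ⟨h1, h2⟩ := Finset.mem_erase.1 hf
      have : f ∈ cutIn F X := mem_cutIn.2 ⟨h2, hfc⟩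
      rw [hcut, Finset.mem_singleton] at this
      exact h1 this
    · obtain ⟨X', hX', hvX', hcut'⟩ := hun v fun h => hv ⟨h, hvX⟩
      refine ⟨X', hX', hvX', Finset.subset_empty.1 (hcut' ▸ ?_)⟩
      exact Finset.filter_subset_filter _ (Finset.erase_subset _ _)

variable (P) in
/-- The properties of the tree `J` that is left after pruning. -/
structure PrunedTree (s : GrowState V) (J : Finset (Sym2 V)) : Prop where
  subset : J ⊆ s.F
  root_mem : P.root ∈ incidentNodes J
  reachable : ∀ v ∈ incidentNodes J,
    (SimpleGraph.fromEdgeSet (J : Set (Sym2 V))).Reachable P.root v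
  T_subset : P.T ⊆ incidentNodes J
  exists_deactivated : ∀ v, v ∉ incidentNodes J →
    ∃ X ∈ s.deactivated, v ∈ X ∧ Disjoint X (incidentNodes J)
  card_cutIn_ne_one : ∀ X ∈ s.deactivated, (cutIn J X).card ≠ 1

theorem mem_incidentNodes {J : Finset (Sym2 V)} {v : V} :
    v ∈ incidentNodes J ↔ ∃ e ∈ J, v ∈ e := by
  simp [incidentNodes]

theorem mem_rootPart {F : Finset (Sym2 V)} {e : Sym2 V} :
    e ∈ P.rootPart F ↔ e ∈ F ∧ ∀ v ∈ e,
      (SimpleGraph.fromEdgeSet (F : Set (Sym2 V))).Reachable P.root v := by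
  simp [rootPart]

omit [Fintype V] in
theorem reachable_of_mem {F : Finset (Sym2 V)} {e : Sym2 V} {a b r : V} (he : e ∈ F)
    (ha : a ∈ e) (hb : b ∈ e)
    (h : (SimpleGraph.fromEdgeSet (F : Set (Sym2 V))).Reachable r a) :
    (SimpleGraph.fromEdgeSet (F : Set (Sym2 V))).Reachable r b := by
  by_cases hab : a = b
  · exact hab ▸ h
  · refine h.trans (SimpleGraph.Adj.reachable ((SimpleGraph.fromEdgeSet_adj _).2 ⟨?_, hab⟩))
    rw [← (Sym2.mem_and_mem_iff hab).1 ⟨ha, hb⟩]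
    simpa using he

/-- The second node `t` excludes the case of an isolated root, whose component has a node but no
edge. -/
theorem mem_incidentNodes_rootPart {F : Finset (Sym2 V)} {t v : V} (ht : t ≠ P.root)
    (htr : (SimpleGraph.fromEdgeSet (F : Set (Sym2 V))).Reachable P.root t) :
    v ∈ incidentNodes (P.rootPart F) ↔
      (SimpleGraph.fromEdgeSet (F : Set (Sym2 V))).Reachable P.root v := by
  rw [mem_incidentNodes]
  constructor
  · rintro ⟨e, he, hv⟩
    exact (mem_rootPart.1 he).2 v hv
  · intro hv
    obtain ⟨w, hw, hwr⟩ : ∃ w, w ≠ v ∧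
        (SimpleGraph.fromEdgeSet (F : Set (Sym2 V))).Reachable P.root w := by
      by_cases h : v = P.root
      · exact ⟨t, h ▸ ht, htr⟩
      · exact ⟨P.root, Ne.symm h, SimpleGraph.Reachable.rfl⟩
    obtain ⟨e, he, a, ha, b, -, rfl⟩ := exists_crosses_of_reachable (S := {v}) (hv.symm.trans hwr)
      (by simp) (by simpa using hw)
    rw [Finset.mem_singleton] at ha
    subst ha
    have hmem : s(a, b) ∈ F := by simpa using he
    exact ⟨s(a, b), mem_rootPart.2 ⟨hmem, fun x hx => reachable_of_mem hmem (by simp) hx hv⟩,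
      by simp⟩

theorem Valid.prunedTree (hs : P.Valid s) (hconn : P.graph.Connected)
    (hTeven : Even P.T.card) (hroot : P.root ∈ P.T) (hpen : ∀ v, 0 ≤ P.penalty v)
    (hlarge : ∀ t ∈ P.T, 2 * ∑ e ∈ P.edges, P.cost e < P.penalty t)
    (hact : s.active = ∅) {F' : Finset (Sym2 V)} (h : PrunesTo s.deactivated s.F F') :
    P.PrunedTree s (P.rootPart F') := by
  obtain ⟨hsub, hun⟩ := hs.pruned hact h.1
  have hTreach : ∀ t ∈ P.T, (SimpleGraph.fromEdgeSet (F' : Set (Sym2 V))).Reachable P.root t := by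
    intro t ht
    by_contra hcon
    obtain ⟨X, hX, htX, -⟩ := hun t hcon
    exact Finset.disjoint_left.1 (hs.disjoint_T hconn hpen hlarge hX) htX ht
  obtain ⟨t, ht, htne⟩ : ∃ t ∈ P.T, t ≠ P.root := by
    have hpos := Finset.card_pos.2 ⟨_, hroot⟩
    obtain ⟨k, hk⟩ := hTeven
    exact Finset.exists_mem_ne (by omega) _
  have hmem : ∀ v, v ∈ incidentNodes (P.rootPart F') ↔
      (SimpleGraph.fromEdgeSet (F' : Set (Sym2 V))).Reachable P.root v := fun v =>
    mem_incidentNodes_rootPart htne (hTreach t ht)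
  have hdisj : ∀ X ∈ s.deactivated, cutIn F' X = ∅ →
      Disjoint X (incidentNodes (P.rootPart F')) := by
    intro X hX hcut
    rw [Finset.disjoint_left]
    intro v hvX hv
    rw [hmem] at hv
    obtain ⟨e, he, hc⟩ := exists_crosses_of_reachable hv.symm hvX (hs.root_notMem_deactivated X hX)
    have : e ∈ cutIn F' X := mem_cutIn.2 ⟨by simpa using he, hc⟩
    simp [hcut] at this
  refine
  { subset := (Finset.filter_subset _ _).trans hsub
    root_mem := (hmem _).2 SimpleGraph.Reachable.rfl
    reachable := fun v hv => ?_
    T_subset := fun t ht => (hmem t).2 (hTreach t ht)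
    exists_deactivated := fun v hv => ?_
    card_cutIn_ne_one := fun X hX hcard => ?_ }
  · rw [hmem] at hv
    have := hv.induct (p := fun v => (SimpleGraph.fromEdgeSet (F' : Set (Sym2 V))).Reachable P.root v ∧
      (SimpleGraph.fromEdgeSet ((P.rootPart F' : Finset (Sym2 V)) : Set (Sym2 V))).Reachable P.root v)
      ⟨SimpleGraph.Reachable.rfl, SimpleGraph.Reachable.rfl⟩ ?_
    · exact this.2
    · rintro a b hab ⟨h1, h2⟩
      refine ⟨h1.trans hab.reachable, h2.trans (SimpleGraph.Adj.reachable ?_)⟩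
      obtain ⟨hab1, hab2⟩ := (SimpleGraph.fromEdgeSet_adj _).1 hab
      have hab1 : s(a, b) ∈ F' := by simpa using hab1
      refine (SimpleGraph.fromEdgeSet_adj _).2 ⟨Finset.mem_coe.2 (mem_rootPart.2 ⟨hab1, ?_⟩), hab2⟩
      exact fun x hx => reachable_of_mem hab1 (by simp) hx h1
  · rw [hmem] at hv
    obtain ⟨X, hX, hvX, hcut⟩ := hun v hv
    exact ⟨X, hX, hvX, hdisj X hX hcut⟩
  · obtain ⟨e, he⟩ := Finset.card_eq_one.1 hcard
    have heJ : e ∈ cutIn (P.rootPart F') X := by simp [he]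
    obtain ⟨heJ, hec⟩ := mem_cutIn.1 heJ
    have heF := (mem_rootPart.1 heJ).1
    -- If `e` were the only edge of `J` crossing `X`, then a further edge `f` of `F'` crosses `X`
    -- outside the root component, as pruning has ended. Its end in `X` lies in a deactivated `X'`
    -- with empty cut, and each laminar position of `X` and `X'` is contradictory.
    have hne : cutIn F' X ≠ {e} := fun hcut => h.2 _ ⟨X, hX, e, hcut, rfl⟩
    obtain ⟨f, hf, hfe⟩ : ∃ f ∈ cutIn F' X, f ≠ e := by
      by_contra! hcon
      exact hne (Finset.eq_singleton_iff_unique_mem.2 ⟨mem_cutIn.2 ⟨heF, hec⟩, hcon⟩)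
    obtain ⟨hfF, a, ha, b, hb, rfl⟩ := mem_cutIn.1 hf
    have hna : ¬ (SimpleGraph.fromEdgeSet (F' : Set (Sym2 V))).Reachable P.root a := by
      intro hra
      refine hfe ?_
      have : s(a, b) ∈ cutIn (P.rootPart F') X := mem_cutIn.2 ⟨mem_rootPart.2 ⟨hfF, fun x hx =>
        reachable_of_mem hfF (by simp) hx hra⟩, a, ha, b, hb, rfl⟩
      rwa [he, Finset.mem_singleton] at this
    obtain ⟨X', hX', haX', hcut⟩ := hun a hna
    rcases hs.laminar X hX X' hX' with hl | hl | hl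
    · obtain ⟨c, hc, d, -, rfl⟩ := hec
      exact Finset.disjoint_left.1 (hdisj X' hX' hcut) (hl hc)
        (mem_incidentNodes.2 ⟨_, heJ, by simp⟩)
    · have : s(a, b) ∈ cutIn F' X' :=
        mem_cutIn.2 ⟨hfF, a, haX', b, fun h => hb (hl h), rfl⟩
      simp [hcut] at this
    · exact Finset.disjoint_left.1 hl ha haX'

/-- The nodes outside `V(J)` are covered by deactivated sets disjoint from `V(J)`, and unions of
deactivated sets are tight. -/
theorem PrunedTree.penLoad_eq {J : Finset (Sym2 V)} (hJ : P.PrunedTree s J) (hs : P.Valid s) :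
    P.penLoad s.y (incidentNodes J)ᶜ = P.pen (incidentNodes J)ᶜ := by
  have : (incidentNodes J)ᶜ =
      (s.deactivated.filter fun X => Disjoint X (incidentNodes J)).biUnion id := by
    ext v
    simp only [Finset.mem_compl, Finset.mem_biUnion, Finset.mem_filter, id]
    constructor
    · intro hv
      obtain ⟨X, hX, hvX, hd⟩ := hJ.exists_deactivated v hv
      exact ⟨X, ⟨hX, hd⟩, hvX⟩
    · rintro ⟨X, ⟨-, hd⟩, hvX⟩
      exact Finset.disjoint_left.1 hd hvX
  rw [this]
  exact (hs.penLoad_biUnion (Finset.filter_subset _ _)).2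

end PCInstance

namespace PCInstance

variable {V : Type*} [Fintype V] {P : PCInstance V} {s : GrowState V}

/-! ### The degree count -/

/-- What later phases add to the chosen edges and the deactivated sets. -/
theorem Valid.later {s' : GrowState V} (hs : P.Valid s)
    (h : Relation.ReflTransGen P.Phase s s') :
    s.deactivated ⊆ s'.deactivated ∧
      ∀ e ∈ s'.F, e ∈ s.F ∨ ∀ C ∈ s.comps, ¬ ∀ v ∈ e, v ∈ C := by
  induction h using Relation.ReflTransGen.head_induction_on with
  | refl => exact ⟨subset_rfl, fun e he => Or.inl he⟩
  | @head a b hab _ ih =>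
    obtain ⟨h1, h2⟩ := ih (hs.phase hab)
    cases hab with
    | merge Δ A B u v hraise hA hB hAB hu hv he htight =>
      refine ⟨h1, fun e he' => ?_⟩
      rcases h2 e he' with h | h
      · rcases Finset.mem_insert.1 h with rfl | h
        · refine Or.inr fun C hC hin => hAB ?_
          rw [hs.eq_of_mem A (hs.active_comps A hA) C hC u hu (hin u (by simp)),
            hs.eq_of_mem B hB C hC v hv (hin v (by simp))]
        · exact Or.inl h
      · refine Or.inr fun C hC hin => ?_
        obtain ⟨C', hC', hsub⟩ := exists_afterMerge_comps_supset (P := P) (A := A) (B := B)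
          (e := s(u, v)) hC
        exact h C' hC' fun w hw => hsub (hin w hw)
    | deactivate Δ S hraise hS htight => exact ⟨(Finset.subset_insert _ _).trans h1, h2⟩

omit [Fintype V] in
-- Only an edge between `A` and `B` is counted in both cuts and missing from the cut of the union;
-- `e` is the only candidate.
theorem card_cutIn_add_le {J : Finset (Sym2 V)} {A B : Finset V} {e : Sym2 V} (hAB : Disjoint A B)
    (h : ∀ a ∈ A, ∀ b ∈ B, s(a, b) ∈ J → s(a, b) = e) :
    (cutIn J A).card + (cutIn J B).card ≤
      (cutIn J (A ∪ B)).card + 2 * if e ∈ J then 1 else 0 := by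
  have hA : ∀ v ∈ A, v ∉ B := fun v h1 h2 => Finset.disjoint_left.1 hAB h1 h2
  have h' : ∀ b ∈ B, ∀ a ∈ A, s(b, a) ∈ J → s(b, a) = e := fun b hb a ha hJ => by
    rw [Sym2.eq_swap] at hJ ⊢
    exact h a ha b hb hJ
  have hcard : (J ∩ {e}).card ≤ if e ∈ J then 1 else 0 := by
    by_cases he : e ∈ J <;> simp [he]
  have h1 : cutIn J A ∩ cutIn J B ⊆ J ∩ {e} := by
    intro f hf
    obtain ⟨hfA, hfB⟩ := Finset.mem_inter.1 hf
    obtain ⟨hfJ, a, ha, b, hb, rfl⟩ := mem_cutIn.1 hfA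
    refine Finset.mem_inter.2 ⟨hfJ, Finset.mem_singleton.2 ?_⟩
    rcases crosses_mk.1 (mem_cutIn.1 hfB).2 with ⟨h2, -⟩ | ⟨h2, -⟩
    · exact absurd h2 (hA a ha)
    · exact h a ha b h2 hfJ
  have h2 : cutIn J A ∪ cutIn J B ⊆ cutIn J (A ∪ B) ∪ (J ∩ {e}) := by
    intro f hf
    rcases Finset.mem_union.1 hf with hf | hf
    · obtain ⟨hfJ, a, ha, b, hb, rfl⟩ := mem_cutIn.1 hf
      by_cases hbB : b ∈ B
      · exact Finset.mem_union_right _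
          (Finset.mem_inter.2 ⟨hfJ, Finset.mem_singleton.2 (h a ha b hbB hfJ)⟩)
      · exact Finset.mem_union_left _ (mem_cutIn.2
          ⟨hfJ, a, Finset.mem_union_left _ ha, b, by simp [hb, hbB], rfl⟩)
    · obtain ⟨hfJ, a, ha, b, hb, rfl⟩ := mem_cutIn.1 hf
      by_cases hbA : b ∈ A
      · exact Finset.mem_union_right _
          (Finset.mem_inter.2 ⟨hfJ, Finset.mem_singleton.2 (h' a ha b hbA hfJ)⟩)
      · exact Finset.mem_union_left _ (mem_cutIn.2
          ⟨hfJ, a, Finset.mem_union_right _ ha, b, by simp [hb, hbA], rfl⟩)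
  have h3 := Finset.card_union_add_card_inter (cutIn J A) (cutIn J B)
  have h4 := Finset.card_le_card h1
  have h5 := (Finset.card_le_card h2).trans (Finset.card_union_le _ _)
  omega

/-- Contracting the sets of the partition turns the tree into a forest; this is its degree
count. -/
theorem Valid.sum_card_cutIn_le {s' : GrowState V} (hs : P.Valid s)
    (h : Relation.ReflTransGen P.Phase s s') {J : Finset (Sym2 V)} (hJ : P.PrunedTree s' J) :
    ∑ C ∈ s.comps, (cutIn J C).card + 2 ≤
      2 * ∑ C ∈ s.comps, if Disjoint C (incidentNodes J) then 0 else 1 := by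
  -- The phases are undone from the end. Finally no edge of `J` crosses a block and the root block
  -- meets `J`. Undoing a merge along `e` in `J` adds at most 2 to the degree sum and at least 1 to
  -- the number of blocks met; if `e` is not in `J`, the degree sum does not grow.
  induction h using Relation.ReflTransGen.head_induction_on with
  | refl =>
    have h1 : ∑ C ∈ s'.comps, (cutIn J C).card = 0 := by
      refine Finset.sum_eq_zero fun C hC => Finset.card_eq_zero.2 ?_
      refine Finset.eq_empty_of_forall_notMem fun e he => ?_
      obtain ⟨he, a, ha, b, hb, rfl⟩ := mem_cutIn.1 he
      obtain ⟨C', hC', hin⟩ := hs.F_inside _ (hJ.subset he)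
      rw [hs.eq_of_mem C hC C' hC' a ha (hin a (by simp))] at hb
      exact hb (hin b (by simp))
    obtain ⟨C, hC, hr⟩ := hs.cover P.root
    have h2 := Finset.single_le_sum (f := fun C => if Disjoint C (incidentNodes J) then 0 else 1)
      (fun C _ => Nat.zero_le _) hC
    have h3 : ¬ Disjoint C (incidentNodes J) :=
      fun hd => Finset.disjoint_left.1 hd hr hJ.root_mem
    simp only [h3, if_false] at h2
    omega
  | @head a b hab hbs ih =>
    have hb := hs.phase hab
    have ih := ih hb
    cases hab with
    | deactivate Δ S hraise hS htight => exact ih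
    | merge Δ A B u v hraise hA hB hAB hu hv he htight =>
      have hAc := hs.active_comps A hA
      have hBA : B ∈ a.comps.erase A := Finset.mem_erase.2 ⟨hAB.symm, hB⟩
      have hnew : A ∪ B ∉ (a.comps.erase A).erase B := by
        intro h
        obtain ⟨-, h2⟩ := Finset.mem_erase.1 h
        obtain ⟨h2, h3⟩ := Finset.mem_erase.1 h2
        exact h2 (hs.eq_of_subset hAc h3 Finset.subset_union_left).symm
      dsimp only at ih
      rw [Finset.sum_insert hnew, Finset.sum_insert hnew] at ih
      rw [← Finset.add_sum_erase _ _ hAc, ← Finset.add_sum_erase _ _ hBA,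
        ← Finset.add_sum_erase _ _ hAc, ← Finset.add_sum_erase _ _ hBA]
      have hdisj : Disjoint A B := Finset.disjoint_left.2 fun w h1 h2 =>
        hAB (hs.eq_of_mem A hAc B hB w h1 h2)
      -- Edges chosen earlier lie inside old blocks and edges chosen later never lie inside `A ∪ B`,
      -- so only `s(u, v)` joins `A` to `B`.
      have hcut := card_cutIn_add_le (J := J) (e := s(u, v)) hdisj (by
        intro x hx z hz hxz
        rcases (hb.later hbs).2 _ (hJ.subset hxz) with h | h
        · rcases Finset.mem_insert.1 h with h | h
          · exact h
          · obtain ⟨C, hC, hin⟩ := hs.F_inside _ h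
            refine absurd ?_ hAB
            rw [hs.eq_of_mem A hAc C hC x hx (hin x (by simp)),
              hs.eq_of_mem B hB C hC z hz (hin z (by simp))]
        · refine absurd ?_ (h (A ∪ B) (Finset.mem_insert_self _ _))
          intro w hw
          rcases Sym2.mem_iff.1 hw with rfl | rfl
          · exact Finset.mem_union_left _ hx
          · exact Finset.mem_union_right _ hz)
      have hmeet : (if Disjoint (A ∪ B) (incidentNodes J) then 0 else 1) +
          (if s(u, v) ∈ J then 1 else 0) ≤ (if Disjoint A (incidentNodes J) then 0 else 1) +
            if Disjoint B (incidentNodes J) then 0 else 1 := by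
        by_cases heJ : s(u, v) ∈ J
        · have h1 : ¬ Disjoint A (incidentNodes J) := fun hd =>
            Finset.disjoint_left.1 hd hu (mem_incidentNodes.2 ⟨_, heJ, by simp⟩)
          have h2 : ¬ Disjoint B (incidentNodes J) := fun hd =>
            Finset.disjoint_left.1 hd hv (mem_incidentNodes.2 ⟨_, heJ, by simp⟩)
          simp only [h1, h2, if_false, heJ, if_true]
          split_ifs <;> omega
        · simp only [heJ, if_false, Finset.disjoint_union_left]
          by_cases h1 : Disjoint A (incidentNodes J) <;>
            by_cases h2 : Disjoint B (incidentNodes J) <;> simp [h1, h2]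
      omega

/-! ### The cost of the tree. -/

/-- The rate at which the bound on the cost of the tree `J` grows with `y_S`, minus the rate at
which the cost of `J` grows. -/
noncomputable def slackRate (P : PCInstance V) (J : Finset (Sym2 V)) (S : Finset V) : ℝ :=
  (if S ∈ P.oddSets then 2 - 1 / ((P.T.card : ℝ) - 1) else 0) +
    (if S ∈ P.evenSets ∧ ¬ S ⊆ (incidentNodes J)ᶜ then 2 else 0) - (cutIn J S).card

theorem PrunedTree.card_cutIn_pos {J : Finset (Sym2 V)} (hJ : P.PrunedTree s J) {S : Finset V}
    {u v : V} (hu : u ∈ S) (hv : v ∉ S) (huJ : u ∈ incidentNodes J) (hvJ : v ∈ incidentNodes J) :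
    1 ≤ (cutIn J S).card := by
  obtain ⟨e, he, hc⟩ := exists_crosses_of_reachable
    ((hJ.reachable u huJ).symm.trans (hJ.reachable v hvJ)) hu hv
  exact Finset.card_pos.2 ⟨e, mem_cutIn.2 ⟨by simpa using he, hc⟩⟩

/-- Active sets are disjoint and avoid the root, and each `T`-odd one contains its own node of `T`.
-/
theorem Valid.card_active_odd_lt (hs : P.Valid s) (hroot : P.root ∈ P.T) :
    (s.active.filter fun S => S ∈ P.oddSets).card + 1 ≤ P.T.card := by
  rw [← Finset.card_erase_add_one hroot]
  refine Nat.add_le_add_right ?_ 1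
  have hex : ∀ S, S ∈ P.oddSets → ∃ t ∈ P.T, t ∈ S := by
    intro S hS
    obtain ⟨t, ht⟩ := Finset.card_pos.1 (P.mem_oddSets.1 hS).2.pos
    exact ⟨t, (Finset.mem_inter.1 ht).2, (Finset.mem_inter.1 ht).1⟩
  have : Nonempty V := ⟨P.root⟩
  choose! f hfT hfS using hex
  refine Finset.card_le_card_of_injOn f ?_ ?_
  · intro S hS
    obtain ⟨hSa, hSo⟩ := Finset.mem_filter.1 (Finset.mem_coe.1 hS)
    refine Finset.mem_coe.2 (Finset.mem_erase.2 ⟨fun h => ?_, hfT S hSo⟩)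
    exact hs.root_notMem_active S hSa (h ▸ hfS S hSo)
  · intro S hS S' hS' heq
    obtain ⟨hSa, hSo⟩ := Finset.mem_filter.1 (Finset.mem_coe.1 hS)
    obtain ⟨hSa', hSo'⟩ := Finset.mem_filter.1 (Finset.mem_coe.1 hS')
    exact hs.eq_of_mem S (hs.active_comps S hSa) S' (hs.active_comps S' hSa') (f S) (hfS S hSo)
      (heq ▸ hfS S' hSo')

/-- With `f C` equal to 2 (if `C` meets `V(J)`, else 0) minus the degree of `C`, the forest count
gives a total of at least 2. Inactive blocks other than the root block `r` contribute at most 0, and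
`r` contributes 2 minus its degree. So the active blocks have total at least the degree of `r`. -/
theorem Valid.sum_slackRate_nonneg {s' : GrowState V} (hs : P.Valid s)
    (h : Relation.ReflTransGen P.Phase s s') {J : Finset (Sym2 V)} (hJ : P.PrunedTree s' J)
    (hT : 2 ≤ P.T.card) (hroot : P.root ∈ P.T) : 0 ≤ ∑ S ∈ s.active, P.slackRate J S := by
  set W := incidentNodes J with hW
  let f : Finset V → ℝ := fun C => 2 * (if Disjoint C W then 0 else 1) - (cutIn J C).card
  have hcount : 2 ≤ ∑ C ∈ s.comps, f C := by
    have := hs.sum_card_cutIn_le h hJ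
    have hcast : ((∑ C ∈ s.comps, (cutIn J C).card + 2 : ℕ) : ℝ) ≤
        ((2 * ∑ C ∈ s.comps, if Disjoint C W then 0 else 1 : ℕ) : ℝ) := by exact_mod_cast this
    push_cast at hcast
    simp only [f]
    rw [Finset.sum_sub_distrib, ← Finset.mul_sum]
    linarith
  obtain ⟨r, hr, hrr⟩ := hs.cover P.root
  have hrna : r ∉ s.active := fun h => hs.root_notMem_active r h hrr
  have hother : ∑ C ∈ s.comps, f C ≤ ∑ S ∈ s.active, f S + f r := by
    rw [← Finset.sum_sdiff (show s.active ⊆ s.comps from hs.active_comps), add_comm]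
    refine add_le_add_right ?_ _
    rw [← Finset.add_sum_erase _ _ (Finset.mem_sdiff.2 ⟨hr, hrna⟩)]
    have : ∑ C ∈ (s.comps \ s.active).erase r, f C ≤ 0 := by
      refine Finset.sum_nonpos fun C hC => ?_
      obtain ⟨hCr, hC⟩ := Finset.mem_erase.1 hC
      obtain ⟨hC, hCa⟩ := Finset.mem_sdiff.1 hC
      have hrC : P.root ∉ C := fun h => hCr (hs.eq_of_mem C hC r hr _ h hrr)
      by_cases hd : Disjoint C W
      · simp [f, hd]
      · obtain ⟨v, hvC, hvW⟩ := Finset.not_disjoint_iff.1 hd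
        have h1 := hJ.card_cutIn_pos hvC hrC hvW hJ.root_mem
        have h2 := hJ.card_cutIn_ne_one C
          ((hs.later h).1 (hs.mem_deactivated C hC hrC hCa))
        have h3 : 2 ≤ (cutIn J C).card := by omega
        have h3' : (2 : ℝ) ≤ (cutIn J C).card := by exact_mod_cast h3
        simp only [f, hd, if_false]
        linarith
    linarith
  have hrW : ¬ Disjoint r W := fun hd => Finset.disjoint_left.1 hd hrr hJ.root_mem
  have hfr : f r = 2 - (cutIn J r).card := by simp [f, hrW]
  have hk : (0 : ℝ) < (P.T.card : ℝ) - 1 := by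
    have : (2 : ℝ) ≤ P.T.card := by exact_mod_cast hT
    linarith
  have hoddW : ∀ S ∈ P.oddSets, ¬ Disjoint S W := by
    intro S hS hd
    obtain ⟨t, ht⟩ := Finset.card_pos.1 (P.mem_oddSets.1 hS).2.pos
    obtain ⟨h1, h2⟩ := Finset.mem_inter.1 ht
    exact Finset.disjoint_left.1 hd h1 (hJ.T_subset h2)
  have hrate : ∀ S ∈ s.active, P.slackRate J S =
      f S - if S ∈ P.oddSets then 1 / ((P.T.card : ℝ) - 1) else 0 := by
    intro S hS
    by_cases ho : S ∈ P.oddSets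
    · have he : S ∉ P.evenSets := Finset.disjoint_left.1 P.disjoint_oddSets_evenSets ho
      simp only [slackRate, f, ho, he, if_true, hoddW S ho, if_false, false_and]
      ring
    · have he : S ∈ P.evenSets := (Finset.mem_union.1 (hs.active_mem hS)).resolve_left ho
      have hiff : S ⊆ Wᶜ ↔ Disjoint S W := Finset.subset_compl_iff_disjoint_right
      simp only [slackRate, f, ho, he, if_false, true_and, ← hW, hiff]
      by_cases hd : Disjoint S W <;> simp [hd]
  rw [Finset.sum_congr rfl hrate, Finset.sum_sub_distrib, ← Finset.sum_filter, Finset.sum_const,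
    nsmul_eq_mul]
  have hn := hs.card_active_odd_lt hroot
  set n := (s.active.filter fun S => S ∈ P.oddSets).card with hn'
  have hcutr : (0 : ℝ) ≤ (cutIn J r).card := by positivity
  -- The `n` active `T`-odd sets use up `n / (|T| - 1)`, which is at most 1. If there is one, it
  -- meets `V(J)` outside `r`, so `r` has degree at least 1 and pays for this.
  rcases Nat.eq_zero_or_pos n with h0 | h0
  · rw [h0, Nat.cast_zero, zero_mul]
    linarith
  · obtain ⟨S, hS⟩ := Finset.card_pos.1 h0
    obtain ⟨hSa, hSo⟩ := Finset.mem_filter.1 hS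
    obtain ⟨v, hvS, hvW⟩ := Finset.not_disjoint_iff.1 (hoddW S hSo)
    have hvr : v ∉ r := fun hv =>
      hrna (hs.eq_of_mem S (hs.active_comps S hSa) r hr v hvS hv ▸ hSa)
    have h1 := hJ.card_cutIn_pos hrr hvr hJ.root_mem hvW
    have h1' : (1 : ℝ) ≤ (cutIn J r).card := by exact_mod_cast h1
    have h2 : (n : ℝ) * (1 / ((P.T.card : ℝ) - 1)) ≤ 1 := by
      have : (n : ℝ) + 1 ≤ P.T.card := by exact_mod_cast hn
      rw [mul_one_div, div_le_one hk]
      linarith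
    linarith

/-- A raise by `Δ` changes the weighted sum by `Δ` times the total rate of the active sets, which is
nonnegative although single rates need not be. -/
theorem Valid.sum_mul_slackRate_le {s' : GrowState V} (hs : P.Valid s)
    (h : Relation.ReflTransGen P.Phase s s') {J : Finset (Sym2 V)} (hJ : P.PrunedTree s' J)
    (hT : 2 ≤ P.T.card) (hroot : P.root ∈ P.T) :
    ∑ S ∈ P.oddSets ∪ P.evenSets, s.y S * P.slackRate J S ≤
      ∑ S ∈ P.oddSets ∪ P.evenSets, s'.y S * P.slackRate J S := by
  induction h using Relation.ReflTransGen.head_induction_on with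
  | refl => exact le_rfl
  | @head a b hab hbs ih =>
    refine le_trans ?_ (ih (hs.phase hab))
    have hnonneg := hs.sum_slackRate_nonneg (hbs.head hab) hJ hT hroot
    have key : ∀ Δ : ℝ, 0 ≤ Δ → ∑ S ∈ P.oddSets ∪ P.evenSets, a.y S * P.slackRate J S ≤
        ∑ S ∈ P.oddSets ∪ P.evenSets, a.raise Δ S * P.slackRate J S := by
      intro Δ hΔ
      have hsub : (P.oddSets ∪ P.evenSets).filter (fun S => S ∈ a.active) = a.active := by
        ext S
        simp only [Finset.mem_filter]
        exact ⟨fun h => h.2, fun h => ⟨hs.active_mem h, h⟩⟩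
      have : ∑ S ∈ P.oddSets ∪ P.evenSets, a.raise Δ S * P.slackRate J S =
          ∑ S ∈ P.oddSets ∪ P.evenSets, a.y S * P.slackRate J S +
            Δ * ∑ S ∈ a.active, P.slackRate J S := by
        rw [← hsub, Finset.sum_filter, Finset.mul_sum, ← Finset.sum_add_distrib]
        refine Finset.sum_congr rfl fun S _ => ?_
        by_cases hS : S ∈ a.active
        · simp [GrowState.raise, hS]; ring
        · simp [GrowState.raise, hS]
      rw [this]
      have := mul_nonneg hΔ hnonneg
      linarith
    cases hab with
    | merge Δ A B u v hraise hA hB hAB hu hv he htight => exact key Δ hraise.2.1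
    | deactivate Δ S hraise hS htight => exact key Δ hraise.2.1

theorem Run.reflTransGen {n : ℕ} (h : P.Run n s) :
    Relation.ReflTransGen P.Phase P.initState s := by
  induction h with
  | init => exact .refl
  | phase _ hphase ih => exact ih.tail hphase

theorem Valid.multiCost_eq (hs : P.Valid s) {K : Finset (Sym2 V)} (hK : K ⊆ s.F) :
    P.multiCost K.val = ∑ S ∈ P.oddSets ∪ P.evenSets, s.y S * ((cutIn K S).card : ℝ) := by
  rw [← sum_edgeLoad]
  exact Finset.sum_congr rfl fun e he => (hs.F_tight e (hK he)).symm

/-- The bound on the cost of the tree. -/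
theorem PrunedTree.multiCost_le {J : Finset (Sym2 V)} (hJ : P.PrunedTree s J)
    (hcost : ∀ e ∈ P.graph.edgeSet, 0 ≤ P.cost e) (hpen : ∀ v, 0 ≤ P.penalty v)
    (hT : 2 ≤ P.T.card) (hroot : P.root ∈ P.T) {n : ℕ} (hrun : P.Run n s) :
    P.multiCost J.val ≤
      (2 - 1 / ((P.T.card : ℝ) - 1)) * ∑ Q ∈ P.oddSets, s.y Q +
        2 * ∑ R ∈ P.evenSets.filter (fun R => ¬ R ⊆ (incidentNodes J)ᶜ), s.y R := by
  -- The weighted sum starts at 0 and ends as the claimed bound minus `c(J)`.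
  have h := (P.valid_initState hcost hpen).sum_mul_slackRate_le hrun.reflTransGen hJ hT hroot
  have h0 : ∑ S ∈ P.oddSets ∪ P.evenSets, P.initState.y S * P.slackRate J S = 0 := by
    simp [initState]
  have h1 : ∑ S ∈ P.oddSets ∪ P.evenSets, s.y S * P.slackRate J S =
      (2 - 1 / ((P.T.card : ℝ) - 1)) * ∑ Q ∈ P.oddSets, s.y Q +
        2 * ∑ R ∈ P.evenSets.filter (fun R => ¬ R ⊆ (incidentNodes J)ᶜ), s.y R -
          P.multiCost J.val := by
    rw [(hrun.valid hcost hpen).multiCost_eq hJ.subset]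
    simp only [slackRate, mul_sub, Finset.sum_sub_distrib]
    congr 1
    rw [Finset.sum_union P.disjoint_oddSets_evenSets, Finset.mul_sum, Finset.mul_sum,
      Finset.sum_filter]
    congr 1
    · refine Finset.sum_congr rfl fun S hS => ?_
      have : S ∉ P.evenSets := Finset.disjoint_left.1 P.disjoint_oddSets_evenSets hS
      simp only [hS, this, if_true, false_and, if_false]
      ring
    · refine Finset.sum_congr rfl fun S hS => ?_
      have : S ∉ P.oddSets := Finset.disjoint_right.1 P.disjoint_oddSets_evenSets hS
      simp only [hS, this, true_and, if_false]
      split_ifs <;> ring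
  linarith

/-! ### The output -/

/-- Removing a `T`-join from the tree leaves a cheap `D`-join. -/
theorem PrunedTree.exists_isJoin {J : Finset (Sym2 V)} (hJ : P.PrunedTree s J) (hs : P.Valid s)
    (hTeven : Even P.T.card) :
    ∃ K : Finset (Sym2 V), P.IsJoin (incidentNodes J) (P.wrongNodes J) K.val ∧
      P.multiCost K.val + ∑ Q ∈ P.oddSets, s.y Q ≤ P.multiCost J.val := by
  obtain ⟨N, hN, hodd⟩ := exists_join_of_reachable P.T
    (fun t ht => hJ.reachable t (hJ.T_subset ht)) hTeven
  have hedge : ∀ e ∈ J, e ∈ P.graph.edgeSet := fun e he =>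
    P.mem_edges.1 (hs.F_edges e (hJ.subset he))
  refine ⟨J \ N, ⟨fun e he => ?_, fun v => ?_⟩, ?_⟩
  · have he : e ∈ J := (Finset.mem_sdiff.1 (Finset.mem_def.2 he)).1
    exact ⟨hedge e he, fun v hv => mem_incidentNodes.2 ⟨e, he, hv⟩⟩
  · have hsymm : J \ N = symmDiff J N := by
      rw [symmDiff_def, Finset.sup_eq_union, Finset.sdiff_eq_empty_iff_subset.2 hN,
        Finset.union_empty]
    rw [hsymm, odd_multiDegree_symmDiff, hodd, wrongNodes, Finset.mem_filter]
    refine ⟨fun h => ⟨?_, h⟩, fun h => h.2⟩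
    by_contra hv
    refine h ⟨fun hd => absurd hd ?_, fun hT => absurd (hJ.T_subset hT) hv⟩
    have : J.filter (fun e => v ∈ e) = ∅ :=
      Finset.filter_eq_empty_iff.2 fun e he hve => hv (mem_incidentNodes.2 ⟨e, he, hve⟩)
    rw [multiDegree_val, this]
    simp
  · have h1 : P.multiCost J.val = P.multiCost (J \ N).val + P.multiCost N.val :=
      (Finset.sum_sdiff hN).symm
    have h2 : ∑ Q ∈ P.oddSets, s.y Q ≤ P.multiCost N.val := by
      obtain ⟨hle, hQ⟩ := P.sum_map_edgeLoad_le_and_one_le_card_crosses hs.dualFeasible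
        (M := N.val) (fun e he => hedge e (hN he)) hodd
      refine le_trans ?_ hle
      rw [sum_map_edgeLoad]
      refine le_trans (Finset.sum_le_sum fun Q hQ' =>
        le_mul_of_one_le_right (hs.y_nonneg Q) (hQ Q hQ')) ?_
      exact Finset.sum_le_sum_of_subset_of_nonneg Finset.subset_union_left fun S _ _ =>
        mul_nonneg (hs.y_nonneg S) (Nat.cast_nonneg _)
    linarith

theorem PrunedTree.induce_connected {J : Finset (Sym2 V)} (hJ : P.PrunedTree s J)
    {E : Set (Sym2 V)} (hE : ∀ e ∈ J, e ∈ E) :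
    ((SimpleGraph.fromEdgeSet E).induce {v | v ∈ incidentNodes J}).Connected := by
  set G := (SimpleGraph.fromEdgeSet E).induce {v | v ∈ incidentNodes J}
  have key : ∀ v (hv : v ∈ incidentNodes J), G.Reachable ⟨P.root, hJ.root_mem⟩ ⟨v, hv⟩ := by
    intro v hv
    refine (hJ.reachable v hv).induct
      (p := fun v => ∀ hv : v ∈ incidentNodes J, G.Reachable ⟨P.root, hJ.root_mem⟩ ⟨v, hv⟩)
      (fun _ => SimpleGraph.Reachable.rfl) ?_ hv
    intro a b hab ih hb
    obtain ⟨hmem, hne⟩ := (SimpleGraph.fromEdgeSet_adj _).1 hab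
    have hmem : s(a, b) ∈ J := by simpa using hmem
    have ha : a ∈ incidentNodes J := mem_incidentNodes.2 ⟨_, hmem, by simp⟩
    refine (ih ha).trans (SimpleGraph.Adj.reachable ?_)
    exact (SimpleGraph.fromEdgeSet_adj _).2 ⟨hE _ hmem, hne⟩
  exact
  { preconnected := fun u v => (key u.1 u.2).symm.trans (key v.1 v.2)
    nonempty := ⟨⟨P.root, hJ.root_mem⟩⟩ }

theorem PrunedTree.isTree {J : Finset (Sym2 V)} (hJ : P.PrunedTree s J) (hs : P.Valid s) :
    ((SimpleGraph.fromEdgeSet (J : Set (Sym2 V))).induce {v | v ∈ incidentNodes J}).IsTree where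
  connected := hJ.induce_connected fun e he => by simpa using he
  isAcyclic := (hs.acyclic.anti (SimpleGraph.fromEdgeSet_mono
    (Finset.coe_subset.2 hJ.subset))).induce _

theorem PrunedTree.isSolution {J : Finset (Sym2 V)} (hJ : P.PrunedTree s J) (hs : P.Valid s)
    {M : Multiset (Sym2 V)} (hM : P.IsJoin (incidentNodes J) (P.wrongNodes J) M) :
    P.IsSolution (incidentNodes J)ᶜ (J.val + M) := by
  refine ⟨?_, ⟨fun e he => ?_, fun v => ?_⟩, ?_⟩
  · exact Finset.disjoint_left.2 fun v hv hT => Finset.mem_compl.1 hv (hJ.T_subset hT)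
  · rw [compl_compl]
    rcases Multiset.mem_add.1 he with he | he
    · exact ⟨P.mem_edges.1 (hs.F_edges e (hJ.subset he)),
        fun v hv => mem_incidentNodes.2 ⟨e, he, hv⟩⟩
    · exact hM.1 e he
  · rw [multiDegree_add, Nat.odd_add, ← Nat.not_odd_iff_even, hM.2, wrongNodes, Finset.mem_filter]
    by_cases hv : v ∈ incidentNodes J
    · simp only [hv, true_and]; tauto
    · have hvT : v ∉ P.T := fun h => hv (hJ.T_subset h)
      have : J.filter (fun e => v ∈ e) = ∅ :=
        Finset.filter_eq_empty_iff.2 fun e he hve => hv (mem_incidentNodes.2 ⟨e, he, hve⟩)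
      have hd : ¬ Odd (multiDegree J.val v) := by
        rw [multiDegree_val, this]
        simp
      simp [hv, hvT, hd]
  · have : {v | v ∉ (incidentNodes J)ᶜ} = {v | v ∈ incidentNodes J} := by
      ext v; simp
    rw [this]
    exact hJ.induce_connected fun e he => Multiset.mem_add.2 (Or.inl he)

/-- Subsets of `I` contain no node of `T`, so those in the support of `y` are `T`-even and all
appear in the penalty load of `I`. -/
theorem PrunedTree.pen_eq {J : Finset (Sym2 V)} (hJ : P.PrunedTree s J) (hs : P.Valid s) :
    P.pen (incidentNodes J)ᶜ = 2 * ∑ X ∈ (incidentNodes J)ᶜ.powerset, s.y X := by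
  rw [← hJ.penLoad_eq hs, penLoad, ← Finset.mul_sum]
  congr 1
  refine Finset.sum_subset (fun R hR => Finset.mem_powerset.2 (Finset.mem_filter.1 hR).2)
    fun S hS hS' => ?_
  by_contra hne
  obtain ⟨h1, h2, -⟩ := hs.y_support S hne
  have hSI := Finset.mem_powerset.1 hS
  refine hS' (Finset.mem_filter.2 ⟨P.mem_evenSets.2 ⟨h2, h1, ?_⟩, hSI⟩)
  have : S ∩ P.T = ∅ := by
    rw [← Finset.disjoint_iff_inter_eq_empty, Finset.disjoint_left]
    exact fun v hv hT => Finset.mem_compl.1 (hSI hv) (hJ.T_subset hT)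
  simp [this]

/-- The `D`-join left in the tree is a competitor in every `U` containing `V(J)`; this covers both
`G[V(J)]` and `G`. -/
theorem PrunedTree.multiCost_join_le {J : Finset (Sym2 V)} (hJ : P.PrunedTree s J)
    (hcost : ∀ e ∈ P.graph.edgeSet, 0 ≤ P.cost e) (hpen : ∀ v, 0 ≤ P.penalty v)
    (hT : 2 ≤ P.T.card) (hTeven : Even P.T.card) (hroot : P.root ∈ P.T) {n : ℕ}
    (hrun : P.Run n s) {U : Finset V} (hU : incidentNodes J ⊆ U) {M : Multiset (Sym2 V)}
    (hM : P.IsMinCostJoin U (P.wrongNodes J) M) :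
    P.multiCost M ≤
      (1 - 1 / ((P.T.card : ℝ) - 1)) * ∑ Q ∈ P.oddSets, s.y Q +
        2 * ∑ R ∈ P.evenSets.filter (fun R => ¬ R ⊆ (incidentNodes J)ᶜ), s.y R := by
  obtain ⟨K, hK, hle⟩ := hJ.exists_isJoin (hrun.valid hcost hpen) hTeven
  have h1 := hM.2 K.val ⟨fun e he => ⟨(hK.1 e he).1, fun v hv => hU ((hK.1 e he).2 v hv)⟩, hK.2⟩
  have h2 := hJ.multiCost_le hcost hpen hT hroot hrun
  linarith

/-- The penalty of `I` cancels exactly against the dual sets inside `I`. The `T`-even sets outside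
need `4 ≤ 2ρ`, the `T`-odd ones `a ≤ ρ`. The constant `a` is separate from `ρ` because for `|T| = 2`
it is only 1. -/
theorem PrunedTree.lmpGuarantee {J : Finset (Sym2 V)} (hJ : P.PrunedTree s J) (hs : P.Valid s)
    (hroot : P.root ∈ P.T) {ρ a : ℝ} (hρ : 2 ≤ ρ) (ha : a ≤ ρ) {F : Multiset (Sym2 V)}
    (hF : P.multiCost F ≤ a * ∑ Q ∈ P.oddSets, s.y Q +
      4 * ∑ R ∈ P.evenSets.filter (fun R => ¬ R ⊆ (incidentNodes J)ᶜ), s.y R) :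
    P.LMPGuarantee ρ s.y (incidentNodes J)ᶜ F := by
  have hQ : 0 ≤ ∑ Q ∈ P.oddSets, s.y Q := Finset.sum_nonneg fun S _ => hs.y_nonneg S
  have hR : 0 ≤ ∑ R ∈ P.evenSets.filter (fun R => ¬ R ⊆ (incidentNodes J)ᶜ), s.y R :=
    Finset.sum_nonneg fun S _ => hs.y_nonneg S
  have hval : P.dualValue s.y = ∑ Q ∈ P.oddSets, s.y Q + (P.pen (incidentNodes J)ᶜ +
      2 * ∑ R ∈ P.evenSets.filter (fun R => ¬ R ⊆ (incidentNodes J)ᶜ), s.y R) := by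
    rw [dualValue, ← hJ.penLoad_eq hs, penLoad, Finset.mul_sum,
      Finset.sum_filter_add_sum_filter_not]
  have h1 : P.multiCost F + ρ * P.pen (incidentNodes J)ᶜ ≤ ρ * P.dualValue s.y := by
    have h2 := mul_le_mul_of_nonneg_right ha hQ
    have h3 := mul_le_mul_of_nonneg_right hρ hR
    rw [hval]
    linarith
  refine ⟨h1, fun I' F' h => h1.trans ?_⟩
  exact mul_le_mul_of_nonneg_left (P.dualValue_le_of_isSolution hroot hs.dualFeasible h)
    (by linarith)

end PCInstance

/-! ### Assembly of the theorem. -/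

theorem mainTheorem3 {V : Type*} [Fintype V] (P : PCInstance V)
    (hconn : P.graph.Connected)
    (hcost : ∀ e ∈ P.graph.edgeSet, 0 ≤ P.cost e)
    (hTeven : Even P.T.card)
    (hroot : P.root ∈ P.T)
    (hpen : ∀ v, 0 ≤ P.penalty v)
    (hlarge : ∀ t ∈ P.T, 2 * ∑ e ∈ P.edges, P.cost e < P.penalty t) :
    -- the growing phase never gets stuck and stops after at most `2|V| - 2` phases
    (∀ n s, P.Run n s → n ≤ 2 * Fintype.card V - 2 ∧
      (s.active.Nonempty → ∃ s', P.Phase s s')) ∧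
    -- the algorithm has an output
    (∃ s J M, P.IsOutput s J M) ∧
    -- every output has the following properties, however ties are broken
    ∀ s J M, P.IsOutput s J M →
      ∀ I : Finset V, I = (incidentNodes J)ᶜ →
      P.DualFeasible s.y ∧
      ((SimpleGraph.fromEdgeSet (J : Set (Sym2 V))).induce {v | v ∈ incidentNodes J}).IsTree ∧
      P.IsSolution I (J.val + M) ∧
      P.pen I = 2 * ∑ X ∈ I.powerset, s.y X ∧
      P.multiCost J.val ≤
        (2 - 1 / ((P.T.card : ℝ) - 1)) * ∑ Q ∈ P.oddSets, s.y Q +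
          2 * ∑ R ∈ P.evenSets.filter (fun R => ¬ R ⊆ I), s.y R ∧
      P.multiCost M ≤
        (1 - 1 / ((P.T.card : ℝ) - 1)) * ∑ Q ∈ P.oddSets, s.y Q +
          2 * ∑ R ∈ P.evenSets.filter (fun R => ¬ R ⊆ I), s.y R ∧
      -- the same bound for minimum-cost `D`-joins of the whole graph
      (∀ M', P.IsMinCostJoin Finset.univ (P.wrongNodes J) M' →
        P.multiCost M' ≤
          (1 - 1 / ((P.T.card : ℝ) - 1)) * ∑ Q ∈ P.oddSets, s.y Q +
            2 * ∑ R ∈ P.evenSets.filter (fun R => ¬ R ⊆ I), s.y R) ∧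
      (4 ≤ P.T.card →
        P.LMPGuarantee (3 - 2 / ((P.T.card : ℝ) - 1)) s.y I (J.val + M)) ∧
      (P.T.card = 2 → P.LMPGuarantee 2 s.y I (J.val + M)) := by
  have hT : 2 ≤ P.T.card := by
    have hpos := Finset.card_pos.2 ⟨_, hroot⟩
    obtain ⟨k, hk⟩ := hTeven
    omega
  have htree : ∀ s J, P.IsTreeOutput s J →
      P.PrunedTree s J ∧ P.Valid s ∧ ∃ n, P.Run n s := by
    rintro s J ⟨⟨n, hrun⟩, hact, F', hF', rfl⟩
    have hs := hrun.valid hcost hpen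
    exact ⟨hs.prunedTree hconn hTeven hroot hpen hlarge hact hF', hs, n, hrun⟩
  refine ⟨fun n s hrun => ⟨hrun.le hcost hpen, (hrun.valid hcost hpen).exists_phase hconn⟩,
    ?_, ?_⟩
  · obtain ⟨n, s, hrun, hact⟩ := PCInstance.exists_run_active_eq_empty hconn hcost hpen
    obtain ⟨F', hF'⟩ := PCInstance.exists_prunesTo s.deactivated s.F
    have hout : P.IsTreeOutput s (P.rootPart F') := ⟨⟨n, hrun⟩, hact, F', hF', rfl⟩
    obtain ⟨hJ, hs, -⟩ := htree _ _ hout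
    obtain ⟨K, hK, -⟩ := hJ.exists_isJoin hs hTeven
    obtain ⟨M, hM⟩ := P.exists_isMinCostJoin hcost hK
    exact ⟨s, _, M, hout, hM⟩
  · rintro s J M ⟨hout, hM⟩ I rfl
    obtain ⟨hJ, hs, n, hrun⟩ := htree s J hout
    have hJcost := hJ.multiCost_le hcost hpen hT hroot hrun
    have hMcost := hJ.multiCost_join_le hcost hpen hT hTeven hroot hrun subset_rfl hM
    refine ⟨hs.dualFeasible, hJ.isTree hs, hJ.isSolution hs hM.1, hJ.pen_eq hs, hJcost, hMcost,
      fun M' hM' => hJ.multiCost_join_le hcost hpen hT hTeven hroot hrun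
        (Finset.subset_univ _) hM', fun h4 => ?_, fun h2 => ?_⟩
    -- This is the sum of the `T`-odd coefficients for `J` and `M`; it is at least 2 since `|T| ≥
    -- 4`.
    · refine hJ.lmpGuarantee hs hroot (a := 3 - 2 / ((P.T.card : ℝ) - 1)) ?_ le_rfl ?_
      · have h4' : (4 : ℝ) ≤ P.T.card := by exact_mod_cast h4
        have : 2 / ((P.T.card : ℝ) - 1) ≤ 1 := by
          rw [div_le_one (by linarith)]
          linarith
        linarith
      · rw [P.multiCost_add]
        refine (add_le_add hJcost hMcost).trans (le_of_eq ?_)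
        ring
    · refine hJ.lmpGuarantee hs hroot (a := 1) le_rfl one_le_two ?_
      rw [P.multiCost_add]
      refine (add_le_add hJcost hMcost).trans (le_of_eq ?_)
      rw [h2]
      norm_num
      ring
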